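/- Let $\Bbbk$ be a commutative ring and $t\in\Bbbk$. A \emph{partition diagram} $k\to l$ is a set partition of $\{1,\dots,k\}\sqcup\{1',\dots,l'\}$ (bottom row, top row); it is a \emph{rook diagram} if all its blocks have size at most $2$ and distinct vertices in the same block lie in distinct rows. For $D\colon l\to m$ and $D'\colon k\to l$, stack $D$ on top of $D'$; let $\alpha(D,D')$ be the number of connected components all of whose vertices lie in the middle row, and let $D\star D'\colon k\to m$ be the partition induced on the bottom and top rows. The partition algebra $P_k(t)$ is the free $\Bbbk$-module on the partition diagrams $k\to k$ with product $D\circ D'=t^{\alpha(D,D')}D\star D'$, and the rook algebra $R_k(t)$ is its subalgebra spanned by the rook diagrams. Let the \emph{rook category} $\mathcal R(t)$ be the strict $\Bbbk$-linear monoidal category generated by one object $1$ (so that the objects are the integers $k\ge 0$, with $k\otimes l=k+l$) and the morphisms $s\colon 2\to2$, $\eta\colon0\to1$, $\varepsilon\colon1\to0$, subject to the relations $$s\circ s=1_2,\quad (1_1\otimes s)(s\otimes 1_1)(1_1\otimes s)=(s\otimes 1_1)(1_1\otimes s)(s\otimes 1_1),\quad s\circ(\eta\otimes 1_1)=1_1\otimes\eta,\quad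 \varepsilon\circ\eta=t\,1_0$$ and their transforms under $*$ (which reverses $\circ$, preserves $\otimes$, fixes $s$ and exchanges $\eta$ and $\varepsilon$) and $\sharp$ (which preserves $\circ$, reverses $\otimes$ and fixes $s,\eta,\varepsilon$). Every word in $s,\eta,\varepsilon$ and identities, built by $\circ$ and $\otimes$, is drawn as a partition diagram by stacking and juxtaposition, with $s$ the crossing and $\eta,\varepsilon$ single isolated vertices; closed components are removed and counted. Then for all $k,l\ge0$ the morphism space $\operatorname{Hom}_{\mathcal R(t)}(k,l)$ has a $\Bbbk$-basis given by all rook diagrams $k\to l$: there are bases $(b_D)$ indexed by the rook diagrams $D\colon k\to l$ such that every word draws a rook diagram $D$ and equals $t^{n}b_D$ in $\mathcal R(t)$, where $n$ is the number of its closed components, and every rook diagram is drawn by some word without closed components. Moreover, for every $k\ge0$, the $\Bbbk$-linear map $b_D\mapsto D$ is an isomorphism of $\Bbbk$-algebras $\operatorname{End}_{\mathcal R(t)}(k)\cong R_k(t)$. -/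

import Mathlib

open CategoryTheory

universe u

noncomputable section

namespace RookTheory

/-! ## Presented strict linear monoidal categories with one generating object

The objects are the tensor powers of the generating object, that is, natural numbers, with
`k ⊗ l = k + l` and unit object `0`. A family `G k l` of generating morphisms `k → l` is given. -/

section Presentation

/-- Formal expressions `k → l` in the generating morphisms `G`, built by identities,
composition (`comp f g` is `f ∘ g`), tensor products, and `𝕜`-linear combinations. -/
inductive Term (𝕜 : Type u) (G : ℕ → ℕ → Type) : ℕ → ℕ → Type u
  | gen {k l : ℕ} (g : G k l) : Term 𝕜 G k l
  | id (k : ℕ) : Term 𝕜 G k k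
  | comp {k l m : ℕ} (f : Term 𝕜 G l m) (g : Term 𝕜 G k l) : Term 𝕜 G k m
  | tensor {k l k' l' : ℕ} (f : Term 𝕜 G k l) (g : Term 𝕜 G k' l') :
      Term 𝕜 G (k + k') (l + l')
  | zero (k l : ℕ) : Term 𝕜 G k l
  | add {k l : ℕ} (f g : Term 𝕜 G k l) : Term 𝕜 G k l
  | smul {k l : ℕ} (a : 𝕜) (f : Term 𝕜 G k l) : Term 𝕜 G k l

/-- Transport of an expression along equalities of objects. -/
def Term.cast {𝕜 : Type u} {G : ℕ → ℕ → Type} {k l k' l' : ℕ} (hk : k = k') (hl : l = l')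
    (f : Term 𝕜 G k l) : Term 𝕜 G k' l' :=
  hl ▸ hk ▸ f

/-- The congruence on expressions generated by the relations `R` and the axioms of a strict
`𝕜`-linear monoidal category. -/
inductive Rel {𝕜 : Type u} [CommRing 𝕜] {G : ℕ → ℕ → Type}
    (R : ∀ ⦃k l : ℕ⦄, Term 𝕜 G k l → Term 𝕜 G k l → Prop) :
    ∀ ⦃k l : ℕ⦄, Term 𝕜 G k l → Term 𝕜 G k l → Prop
  -- the given relations
  | of {k l : ℕ} {f g : Term 𝕜 G k l} : R f g → Rel R f g
  -- equivalence relation, compatible with all operations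
  | refl {k l : ℕ} (f : Term 𝕜 G k l) : Rel R f f
  | symm {k l : ℕ} {f g : Term 𝕜 G k l} : Rel R f g → Rel R g f
  | trans {k l : ℕ} {f g h : Term 𝕜 G k l} : Rel R f g → Rel R g h → Rel R f h
  | comp_congr {k l m : ℕ} {f f' : Term 𝕜 G l m} {g g' : Term 𝕜 G k l} :
      Rel R f f' → Rel R g g' → Rel R (f.comp g) (f'.comp g')
  | tensor_congr {k l k' l' : ℕ} {f f' : Term 𝕜 G k l} {g g' : Term 𝕜 G k' l'} :
      Rel R f f' → Rel R g g' → Rel R (f.tensor g) (f'.tensor g')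
  | add_congr {k l : ℕ} {f f' g g' : Term 𝕜 G k l} :
      Rel R f f' → Rel R g g' → Rel R (f.add g) (f'.add g')
  | smul_congr {k l : ℕ} (a : 𝕜) {f f' : Term 𝕜 G k l} :
      Rel R f f' → Rel R (f.smul a) (f'.smul a)
  -- category
  | id_comp {k l : ℕ} (f : Term 𝕜 G k l) : Rel R ((Term.id l).comp f) f
  | comp_id {k l : ℕ} (f : Term 𝕜 G k l) : Rel R (f.comp (Term.id k)) f
  | comp_assoc {k l m n : ℕ} (f : Term 𝕜 G m n) (g : Term 𝕜 G l m) (h : Term 𝕜 G k l) :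
      Rel R ((f.comp g).comp h) (f.comp (g.comp h))
  -- morphism spaces are modules
  | add_comm {k l : ℕ} (f g : Term 𝕜 G k l) : Rel R (f.add g) (g.add f)
  | add_assoc {k l : ℕ} (f g h : Term 𝕜 G k l) : Rel R ((f.add g).add h) (f.add (g.add h))
  | zero_add {k l : ℕ} (f : Term 𝕜 G k l) : Rel R ((Term.zero k l).add f) f
  | one_smul {k l : ℕ} (f : Term 𝕜 G k l) : Rel R (f.smul 1) f
  | mul_smul {k l : ℕ} (a b : 𝕜) (f : Term 𝕜 G k l) :
      Rel R (f.smul (a * b)) ((f.smul b).smul a)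
  | smul_add {k l : ℕ} (a : 𝕜) (f g : Term 𝕜 G k l) :
      Rel R ((f.add g).smul a) ((f.smul a).add (g.smul a))
  | add_smul {k l : ℕ} (a b : 𝕜) (f : Term 𝕜 G k l) :
      Rel R (f.smul (a + b)) ((f.smul a).add (f.smul b))
  | zero_smul {k l : ℕ} (f : Term 𝕜 G k l) : Rel R (f.smul 0) (Term.zero k l)
  -- composition is bilinear
  | comp_add {k l m : ℕ} (f : Term 𝕜 G l m) (g h : Term 𝕜 G k l) :
      Rel R (f.comp (g.add h)) ((f.comp g).add (f.comp h))
  | add_comp {k l m : ℕ} (f g : Term 𝕜 G l m) (h : Term 𝕜 G k l) :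
      Rel R ((f.add g).comp h) ((f.comp h).add (g.comp h))
  | comp_smul {k l m : ℕ} (a : 𝕜) (f : Term 𝕜 G l m) (g : Term 𝕜 G k l) :
      Rel R (f.comp (g.smul a)) ((f.comp g).smul a)
  | smul_comp {k l m : ℕ} (a : 𝕜) (f : Term 𝕜 G l m) (g : Term 𝕜 G k l) :
      Rel R ((f.smul a).comp g) ((f.comp g).smul a)
  -- the tensor product is a bifunctor
  | tensor_id (k l : ℕ) : Rel R ((Term.id k).tensor (Term.id l)) (Term.id (k + l))
  | interchange {k l m k' l' m' : ℕ} (f : Term 𝕜 G l m) (g : Term 𝕜 G k l)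
      (f' : Term 𝕜 G l' m') (g' : Term 𝕜 G k' l') :
      Rel R ((f.tensor f').comp (g.tensor g')) ((f.comp g).tensor (f'.comp g'))
  -- the tensor product is bilinear
  | tensor_add {k l k' l' : ℕ} (f : Term 𝕜 G k l) (g h : Term 𝕜 G k' l') :
      Rel R (f.tensor (g.add h)) ((f.tensor g).add (f.tensor h))
  | add_tensor {k l k' l' : ℕ} (f g : Term 𝕜 G k l) (h : Term 𝕜 G k' l') :
      Rel R ((f.add g).tensor h) ((f.tensor h).add (g.tensor h))
  | tensor_smul {k l k' l' : ℕ} (a : 𝕜) (f : Term 𝕜 G k l) (g : Term 𝕜 G k' l') :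
      Rel R (f.tensor (g.smul a)) ((f.tensor g).smul a)
  | smul_tensor {k l k' l' : ℕ} (a : 𝕜) (f : Term 𝕜 G k l) (g : Term 𝕜 G k' l') :
      Rel R ((f.smul a).tensor g) ((f.tensor g).smul a)
  -- the tensor product is strictly associative and unital
  | tensor_assoc {k l k' l' k'' l'' : ℕ} (f : Term 𝕜 G k l) (g : Term 𝕜 G k' l')
      (h : Term 𝕜 G k'' l'') :
      Rel R (((f.tensor g).tensor h).cast (Nat.add_assoc k k' k'') (Nat.add_assoc l l' l''))
        (f.tensor (g.tensor h))
  | one_tensor {k l : ℕ} (f : Term 𝕜 G k l) :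
      Rel R (((Term.id 0).tensor f).cast (Nat.zero_add k) (Nat.zero_add l)) f
  | tensor_one {k l : ℕ} (f : Term 𝕜 G k l) :
      Rel R ((f.tensor (Term.id 0)).cast (Nat.add_zero k) (Nat.add_zero l)) f

variable {𝕜 : Type u} [CommRing 𝕜] {G : ℕ → ℕ → Type}
  (R : ∀ ⦃k l : ℕ⦄, Term 𝕜 G k l → Term 𝕜 G k l → Prop)

/-- The congruence `Rel R` on expressions `k → l`, as a setoid. -/
@[reducible]
def relSetoid (k l : ℕ) : Setoid (Term 𝕜 G k l) where
  r := @Rel 𝕜 _ G R k l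
  iseqv := ⟨Rel.refl, Rel.symm, Rel.trans⟩

/-- The morphism space `Hom(k, l)` of the presented category. -/
def PHom (k l : ℕ) : Type u := Quotient (relSetoid R k l)

namespace PHom

variable {R}

/-- The morphism represented by an expression. -/
def mk {k l : ℕ} (f : Term 𝕜 G k l) : PHom R k l := Quotient.mk (relSetoid R k l) f

theorem sound {k l : ℕ} {f g : Term 𝕜 G k l} (h : Rel R f g) : (mk f : PHom R k l) = mk g :=
  Quotient.sound (s := relSetoid R k l) h

theorem exists_rep {k l : ℕ} (f : PHom R k l) : ∃ f' : Term 𝕜 G k l, mk f' = f :=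
  Quotient.exists_rep f

/-- Composition `f ∘ g`. -/
def comp {k l m : ℕ} (f : PHom R l m) (g : PHom R k l) : PHom R k m :=
  Quotient.map₂ Term.comp (fun _ _ h _ _ h' => Rel.comp_congr h h') f g

/-- Tensor product `f ⊗ g`. -/
def tensor {k l k' l' : ℕ} (f : PHom R k l) (g : PHom R k' l') : PHom R (k + k') (l + l') :=
  Quotient.map₂ Term.tensor (fun _ _ h _ _ h' => Rel.tensor_congr h h') f g

instance (k l : ℕ) : Zero (PHom R k l) := ⟨mk (Term.zero k l)⟩
instance (k l : ℕ) : Add (PHom R k l) :=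
  ⟨Quotient.map₂ Term.add (fun _ _ h _ _ h' => Rel.add_congr h h')⟩
instance (k l : ℕ) : SMul 𝕜 (PHom R k l) :=
  ⟨fun a => Quotient.map (Term.smul a) (fun _ _ h => Rel.smul_congr a h)⟩
instance (k l : ℕ) : Neg (PHom R k l) := ⟨fun f => (-1 : 𝕜) • f⟩

theorem one_smul' {k l : ℕ} (f : PHom R k l) : (1 : 𝕜) • f = f := by
  obtain ⟨f, rfl⟩ := exists_rep f
  exact sound (Rel.one_smul f)

theorem add_smul' {k l : ℕ} (a b : 𝕜) (f : PHom R k l) : (a + b) • f = a • f + b • f := by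
  obtain ⟨f, rfl⟩ := exists_rep f
  exact sound (Rel.add_smul a b f)

theorem zero_smul' {k l : ℕ} (f : PHom R k l) : (0 : 𝕜) • f = 0 := by
  obtain ⟨f, rfl⟩ := exists_rep f
  exact sound (Rel.zero_smul f)

theorem mul_smul' {k l : ℕ} (a b : 𝕜) (f : PHom R k l) : (a * b) • f = a • b • f := by
  obtain ⟨f, rfl⟩ := exists_rep f
  exact sound (Rel.mul_smul a b f)

theorem add_comm' {k l : ℕ} (f g : PHom R k l) : f + g = g + f := by
  obtain ⟨f, rfl⟩ := exists_rep f
  obtain ⟨g, rfl⟩ := exists_rep g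
  exact sound (Rel.add_comm f g)

theorem zero_add' {k l : ℕ} (f : PHom R k l) : 0 + f = f := by
  obtain ⟨f, rfl⟩ := exists_rep f
  exact sound (Rel.zero_add f)

instance (k l : ℕ) : AddCommGroup (PHom R k l) where
  add_assoc f g h := by
    obtain ⟨f, rfl⟩ := exists_rep f
    obtain ⟨g, rfl⟩ := exists_rep g
    obtain ⟨h, rfl⟩ := exists_rep h
    exact sound (Rel.add_assoc f g h)
  zero_add := zero_add'
  add_zero f := by rw [add_comm', zero_add']
  nsmul := nsmulRec
  zsmul := zsmulRec
  neg_add_cancel f := by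
    change (-1 : 𝕜) • f + f = 0
    conv_lhs => arg 2; rw [← one_smul' f]
    rw [← add_smul', neg_add_cancel, zero_smul']
  add_comm := add_comm'

instance (k l : ℕ) : Module 𝕜 (PHom R k l) where
  one_smul := one_smul'
  mul_smul := mul_smul'
  smul_zero a := by
    rw [← zero_smul' (0 : PHom R k l), ← mul_smul', mul_zero]
  smul_add a f g := by
    obtain ⟨f, rfl⟩ := exists_rep f
    obtain ⟨g, rfl⟩ := exists_rep g
    exact sound (Rel.smul_add a f g)
  add_smul := add_smul'
  zero_smul := zero_smul'

end PHom

/-- The strict `𝕜`-linear monoidal category generated by one object and the morphisms `G`,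
subject to the relations `R`. Its objects are the tensor powers of the generating object. -/
@[ext]
structure PresentedCategory (R : ∀ ⦃k l : ℕ⦄, Term 𝕜 G k l → Term 𝕜 G k l → Prop) : Type where
  /-- The object `k`, that is, the `k`-th tensor power of the generating object. -/
  obj ::
  /-- The number of tensor factors of an object. -/
  deg : ℕ

namespace PresentedCategory

variable {R}

instance : Category.{u, 0} (PresentedCategory R) where
  Hom X Y := PHom R X.deg Y.deg
  id X := PHom.mk (Term.id X.deg)
  comp f g := PHom.comp g f
  id_comp f := by
    obtain ⟨f, rfl⟩ := PHom.exists_rep f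
    exact PHom.sound (Rel.comp_id f)
  comp_id f := by
    obtain ⟨f, rfl⟩ := PHom.exists_rep f
    exact PHom.sound (Rel.id_comp f)
  assoc f g h := by
    obtain ⟨f, rfl⟩ := PHom.exists_rep f
    obtain ⟨g, rfl⟩ := PHom.exists_rep g
    obtain ⟨h, rfl⟩ := PHom.exists_rep h
    exact (PHom.sound (Rel.comp_assoc h g f)).symm

/-- The morphism of the presented category represented by an expression. -/
def homMk (R : ∀ ⦃k l : ℕ⦄, Term 𝕜 G k l → Term 𝕜 G k l → Prop) {k l : ℕ}
    (f : Term 𝕜 G k l) : (obj k : PresentedCategory R) ⟶ obj l :=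
  PHom.mk f

theorem homMk_sound {k l : ℕ} {f g : Term 𝕜 G k l} (h : Rel R f g) : homMk R f = homMk R g :=
  PHom.sound h

theorem exists_homMk {X Y : PresentedCategory R} (f : X ⟶ Y) :
    ∃ f' : Term 𝕜 G X.deg Y.deg, homMk R f' = f :=
  PHom.exists_rep f

instance : Preadditive (PresentedCategory R) where
  homGroup X Y := inferInstanceAs (AddCommGroup (PHom R X.deg Y.deg))
  add_comp _ _ _ f g h := by
    obtain ⟨f, rfl⟩ := exists_homMk f
    obtain ⟨g, rfl⟩ := exists_homMk g
    obtain ⟨h, rfl⟩ := exists_homMk h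
    exact homMk_sound (Rel.comp_add h f g)
  comp_add _ _ _ f g h := by
    obtain ⟨f, rfl⟩ := exists_homMk f
    obtain ⟨g, rfl⟩ := exists_homMk g
    obtain ⟨h, rfl⟩ := exists_homMk h
    exact homMk_sound (Rel.add_comp g h f)

instance : Linear 𝕜 (PresentedCategory R) where
  homModule X Y := inferInstanceAs (Module 𝕜 (PHom R X.deg Y.deg))
  smul_comp _ _ _ a f g := by
    obtain ⟨f, rfl⟩ := exists_homMk f
    obtain ⟨g, rfl⟩ := exists_homMk g
    exact homMk_sound (Rel.comp_smul a g f)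
  comp_smul _ _ _ f a g := by
    obtain ⟨f, rfl⟩ := exists_homMk f
    obtain ⟨g, rfl⟩ := exists_homMk g
    exact homMk_sound (Rel.smul_comp a g f)

theorem homMk_cast {k l k' l' : ℕ} (hk : k = k') (hl : l = l') (f : Term 𝕜 G k l) :
    homMk R (f.cast hk hl) =
      eqToHom (congrArg obj hk.symm) ≫ homMk R f ≫ eqToHom (congrArg obj hl) := by
  subst hk hl
  simp [Term.cast]

instance : MonoidalCategoryStruct (PresentedCategory R) where
  tensorObj X Y := obj (X.deg + Y.deg)
  tensorUnit := obj 0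
  tensorHom f g := PHom.tensor f g
  whiskerLeft X _ _ f := PHom.tensor (PHom.mk (Term.id X.deg)) f
  whiskerRight f X := PHom.tensor f (PHom.mk (Term.id X.deg))
  associator X Y Z := eqToIso (congrArg obj (Nat.add_assoc X.deg Y.deg Z.deg))
  leftUnitor X := eqToIso (congrArg obj (Nat.zero_add X.deg))
  rightUnitor X := eqToIso (congrArg obj (Nat.add_zero X.deg))

open MonoidalCategory in
theorem eqToHom_tensor_id {X X' : PresentedCategory R} (h : X = X') (Y : PresentedCategory R) :
    eqToHom h ⊗ₘ 𝟙 Y = eqToHom (congrArg (fun Z => Z ⊗ Y) h) := by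
  subst h
  exact homMk_sound (Rel.tensor_id _ _)

open MonoidalCategory in
theorem id_tensor_eqToHom {X X' : PresentedCategory R} (h : X = X') (Y : PresentedCategory R) :
    𝟙 Y ⊗ₘ eqToHom h = eqToHom (congrArg (fun Z => Y ⊗ Z) h) := by
  subst h
  exact homMk_sound (Rel.tensor_id _ _)

open MonoidalCategory in
instance : MonoidalCategory (PresentedCategory R) :=
  MonoidalCategory.ofTensorHom
    (id_tensorHom_id := fun _ _ => homMk_sound (Rel.tensor_id _ _))
    (id_tensorHom := fun _ _ _ _ => rfl)
    (tensorHom_id := fun _ _ => rfl)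
    (tensorHom_comp_tensorHom := fun f f' g g' => by
      obtain ⟨f, rfl⟩ := exists_homMk f
      obtain ⟨g, rfl⟩ := exists_homMk g
      obtain ⟨f', rfl⟩ := exists_homMk f'
      obtain ⟨g', rfl⟩ := exists_homMk g'
      exact homMk_sound (Rel.interchange g f g' f'))
    (associator_naturality := fun f g h => by
      obtain ⟨f, rfl⟩ := exists_homMk f
      obtain ⟨g, rfl⟩ := exists_homMk g
      obtain ⟨h, rfl⟩ := exists_homMk h
      have := homMk_sound (Rel.tensor_assoc (R := R) f g h)
      rw [homMk_cast] at this
      change homMk R ((f.tensor g).tensor h) ≫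
          eqToHom (congrArg obj (Nat.add_assoc _ _ _)) =
        eqToHom (congrArg obj (Nat.add_assoc _ _ _)) ≫ homMk R (f.tensor (g.tensor h))
      rw [← this]
      simp)
    (leftUnitor_naturality := fun f => by
      obtain ⟨f, rfl⟩ := exists_homMk f
      have := homMk_sound (Rel.one_tensor (R := R) f)
      rw [homMk_cast] at this
      change homMk R ((Term.id 0).tensor f) ≫ eqToHom (congrArg obj (Nat.zero_add _)) =
        eqToHom (congrArg obj (Nat.zero_add _)) ≫ homMk R f
      rw [← this]
      simp)
    (rightUnitor_naturality := fun f => by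
      obtain ⟨f, rfl⟩ := exists_homMk f
      have := homMk_sound (Rel.tensor_one (R := R) f)
      rw [homMk_cast] at this
      change homMk R (f.tensor (Term.id 0)) ≫ eqToHom (congrArg obj (Nat.add_zero _)) =
        eqToHom (congrArg obj (Nat.add_zero _)) ≫ homMk R f
      rw [← this]
      simp)
    (pentagon := fun W X Y Z => by
      change (eqToHom (congrArg obj (Nat.add_assoc _ _ _)) ⊗ₘ 𝟙 Z) ≫
          eqToHom (congrArg obj (Nat.add_assoc _ _ _)) ≫
            (𝟙 W ⊗ₘ eqToHom (congrArg obj (Nat.add_assoc _ _ _))) =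
        eqToHom (congrArg obj (Nat.add_assoc _ _ _)) ≫
          eqToHom (congrArg obj (Nat.add_assoc _ _ _))
      rw [eqToHom_tensor_id, id_tensor_eqToHom]
      simp)
    (triangle := fun X Y => by
      change eqToHom (congrArg obj (Nat.add_assoc _ _ _)) ≫
          (𝟙 X ⊗ₘ eqToHom (congrArg obj (Nat.zero_add _))) =
        eqToHom (congrArg obj (Nat.add_zero _)) ⊗ₘ 𝟙 Y
      rw [eqToHom_tensor_id, id_tensor_eqToHom]
      simp
      rfl)

instance : MonoidalPreadditive (PresentedCategory R) where
  whiskerLeft_zero := by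
    intro X Y Z
    have h := homMk_sound (Rel.tensor_smul (R := R) 0 (Term.id X.deg) (Term.zero Y.deg Z.deg))
    rw [homMk_sound (Rel.zero_smul _),
      homMk_sound (Rel.tensor_congr (Rel.refl _) (Rel.zero_smul _))] at h
    exact h
  zero_whiskerRight := by
    intro X Y Z
    have h := homMk_sound (Rel.smul_tensor (R := R) 0 (Term.zero Y.deg Z.deg) (Term.id X.deg))
    rw [homMk_sound (Rel.zero_smul _),
      homMk_sound (Rel.tensor_congr (Rel.zero_smul _) (Rel.refl _))] at h
    exact h
  whiskerLeft_add := by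
    intro X Y Z f g
    obtain ⟨f, rfl⟩ := exists_homMk f
    obtain ⟨g, rfl⟩ := exists_homMk g
    exact homMk_sound (Rel.tensor_add _ f g)
  add_whiskerRight := by
    intro X Y Z f g
    obtain ⟨f, rfl⟩ := exists_homMk f
    obtain ⟨g, rfl⟩ := exists_homMk g
    exact homMk_sound (Rel.add_tensor f g _)

instance : MonoidalLinear 𝕜 (PresentedCategory R) where
  whiskerLeft_smul := by
    intro X Y Z a f
    obtain ⟨f, rfl⟩ := exists_homMk f
    exact homMk_sound (Rel.tensor_smul a _ f)
  smul_whiskerRight := by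
    intro a Y Z f X
    obtain ⟨f, rfl⟩ := exists_homMk f
    exact homMk_sound (Rel.smul_tensor a f _)

end PresentedCategory

end Presentation

/-! ## Partition diagrams -/

section Setoid

variable {U V W Z : Type}

/-- The classes of `r` that contain no point in the image of `f`. -/
def Missed (r : Setoid V) (f : W → V) : Type := {c : Quotient r // ∀ w, Quotient.mk r (f w) ≠ c}

theorem map_le_iff {r : Setoid W} {f : W → V} {q : Setoid V} :
    r.map f ≤ q ↔ ∀ x y, r x y → q (f x) (f y) := by
  constructor
  · intro h x y hxy
    exact h (Relation.EqvGen.rel _ _ ⟨x, y, hxy, rfl, rfl⟩)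
  · intro h
    refine Setoid.eqvGen_le ?_
    rintro _ _ ⟨x, y, hxy, rfl, rfl⟩
    exact h x y hxy

theorem map_rel {r : Setoid W} {f : W → V} {x y : W} (h : r x y) : r.map f (f x) (f y) :=
  Relation.EqvGen.rel _ _ ⟨x, y, h, rfl, rfl⟩

theorem map_iff {r : Setoid W} {f : W → V} (hf : Function.Injective f) (x y : V) :
    r.map f x y ↔ x = y ∨ ∃ a b, r a b ∧ f a = x ∧ f b = y := by
  have h := Setoid.coe_map_of_ker_le r f (by
    intro a b hab
    rw [hf hab])
  have := congrFun (congrFun h x) y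
  rw [this]
  simp only [Pi.sup_apply, sup_Prop_eq, Relation.Map]
  exact or_comm

theorem map_map_setoid (r : Setoid W) (f : W → V) (g : V → U) :
    (r.map f).map g = r.map (g ∘ f) := by
  apply le_antisymm
  · rw [map_le_iff]
    have : r.map f ≤ (r.map (g ∘ f)).comap g := by
      rw [map_le_iff]
      intro x y h
      exact map_rel (f := g ∘ f) h
    exact fun x y h => this h
  · rw [map_le_iff]
    intro x y h
    exact map_rel (map_rel h)

theorem map_sup_setoid (r s : Setoid W) (f : W → V) :
    (r ⊔ s).map f = r.map f ⊔ s.map f := by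
  apply le_antisymm
  · rw [map_le_iff]
    have : r ⊔ s ≤ (r.map f ⊔ s.map f).comap f := by
      refine sup_le ?_ ?_
      · intro x y h
        exact (le_sup_left : r.map f ≤ _) (map_rel h)
      · intro x y h
        exact (le_sup_right : s.map f ≤ _) (map_rel h)
    exact fun x y h => this h
  · refine sup_le ?_ ?_ <;> rw [map_le_iff] <;> intro x y h
    · exact map_rel ((le_sup_left : r ≤ r ⊔ s) h)
    · exact map_rel ((le_sup_right : s ≤ r ⊔ s) h)

theorem sup_map_iff (r : Setoid V) (s : Setoid W) (f : W → V) (x y : V) :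
    (r ⊔ s.map f) x y ↔ r x y ∨ ∃ u v, r x (f u) ∧ (r.comap f ⊔ s) u v ∧ r (f v) y := by
  have hle : r.comap f ⊔ s ≤ (r ⊔ s.map f).comap f := by
    refine sup_le ?_ ?_
    · intro x y h
      exact (le_sup_left : r ≤ r ⊔ s.map f) h
    · intro x y h
      exact (le_sup_right : s.map f ≤ r ⊔ s.map f) (map_rel h)
  constructor
  · let T : Setoid V :=
      { r := fun x y => r x y ∨ ∃ u v, r x (f u) ∧ (r.comap f ⊔ s) u v ∧ r (f v) y
        iseqv := by
          refine ⟨fun x => Or.inl (r.refl' x), ?_, ?_⟩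
          · rintro x y (h | ⟨u, v, h1, h2, h3⟩)
            · exact Or.inl (r.symm' h)
            · exact Or.inr ⟨v, u, r.symm' h3, Setoid.symm' _ h2, r.symm' h1⟩
          · rintro x y z (h | ⟨u, v, h1, h2, h3⟩) (h' | ⟨u', v', h1', h2', h3'⟩)
            · exact Or.inl (r.trans' h h')
            · exact Or.inr ⟨u', v', r.trans' h h1', h2', h3'⟩
            · exact Or.inr ⟨u, v, h1, h2, r.trans' h3 h'⟩
            · refine Or.inr ⟨u, v', h1, ?_, h3'⟩
              have : (r.comap f ⊔ s) v u' :=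
                (le_sup_left : r.comap f ≤ r.comap f ⊔ s)
                  (show r (f v) (f u') from r.trans' h3 h1')
              exact Setoid.trans' _ h2 (Setoid.trans' _ this h2') }
    have hT : r ⊔ s.map f ≤ T := by
      refine sup_le (fun x y h => Or.inl h) ?_
      rw [map_le_iff]
      intro u v h
      exact Or.inr ⟨u, v, r.refl' _, (le_sup_right : s ≤ _) h, r.refl' _⟩
    exact fun h => hT h
  · have hl : r ≤ r ⊔ s.map f := le_sup_left
    rintro (h | ⟨u, v, h1, h2, h3⟩)
    · exact hl h
    · exact Setoid.trans' _ (hl h1) (Setoid.trans' _ (hle h2) (hl h3))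

theorem comap_sup_map (r : Setoid V) (s : Setoid W) (f : W → V) :
    (r ⊔ s.map f).comap f = r.comap f ⊔ s := by
  ext x y
  rw [Setoid.comap_rel, sup_map_iff]
  constructor
  · rintro (h | ⟨u, v, h1, h2, h3⟩)
    · exact (le_sup_left : r.comap f ≤ _) h
    · have hl : r.comap f ≤ r.comap f ⊔ s := le_sup_left
      exact Setoid.trans' _ (hl h1) (Setoid.trans' _ h2 (hl h3))
  · intro h
    exact Or.inr ⟨x, y, r.refl' _, h, r.refl' _⟩

theorem card_missed_sup_map [Finite V] [Finite W] (r : Setoid V) (s : Setoid W) (f : W → V)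
    (p : Z → W) :
    Nat.card (Missed (r ⊔ s.map f) (f ∘ p)) =
      Nat.card (Missed r f) + Nat.card (Missed (r.comap f ⊔ s) p) := by
  have hle : r ≤ r ⊔ s.map f := le_sup_left
  let F : Missed r f ⊕ Missed (r.comap f ⊔ s) p → Missed (r ⊔ s.map f) (f ∘ p) :=
    Sum.elim
      (fun c => ⟨Quotient.map' id (fun _ _ h => hle h) c.1, by
        obtain ⟨c, hc⟩ := c
        induction c using Quotient.inductionOn with
        | h x =>
          intro w hw
          have hw : (r ⊔ s.map f) (f (p w)) x := Quotient.exact hw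
          rw [sup_map_iff] at hw
          rcases hw with h | ⟨u, v, -, -, h3⟩
          · exact hc _ (Quotient.sound h)
          · exact hc _ (Quotient.sound h3)⟩)
      (fun c => ⟨Quotient.map' f (fun a b h => by
          change (r ⊔ s.map f).comap f a b
          rw [comap_sup_map]; exact h) c.1, by
        obtain ⟨c, hc⟩ := c
        induction c using Quotient.inductionOn with
        | h x =>
          intro w hw
          have hw : (r ⊔ s.map f) (f (p w)) (f x) := Quotient.exact hw
          have hw : (r ⊔ s.map f).comap f (p w) x := hw
          rw [comap_sup_map] at hw
          exact hc _ (Quotient.sound hw)⟩)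
  have hF : Function.Bijective F := by
    constructor
    · rintro (⟨c, hc⟩ | ⟨c, hc⟩) (⟨d, hd⟩ | ⟨d, hd⟩) h <;>
        induction c using Quotient.inductionOn with | h x => ?_ <;>
        induction d using Quotient.inductionOn with | h y => ?_ <;>
        have h := Quotient.exact (congrArg Subtype.val h)
      · have h : (r ⊔ s.map f) x y := h
        rw [sup_map_iff] at h
        rcases h with h | ⟨u, v, h1, -, -⟩
        · congr 2; exact Quotient.sound h
        · exact (hc u (Quotient.sound (r.symm' h1))).elim
      · have h : (r ⊔ s.map f) x (f y) := h
        rw [sup_map_iff] at h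
        rcases h with h | ⟨u, v, h1, -, -⟩
        · exact (hc y (Quotient.sound (r.symm' h))).elim
        · exact (hc u (Quotient.sound (r.symm' h1))).elim
      · have h : (r ⊔ s.map f) (f x) y := h
        rw [sup_map_iff] at h
        rcases h with h | ⟨u, v, -, -, h3⟩
        · exact (hd x (Quotient.sound h)).elim
        · exact (hd v (Quotient.sound h3)).elim
      · have h : (r ⊔ s.map f).comap f x y := h
        rw [comap_sup_map] at h
        congr 2; exact Quotient.sound h
    · rintro ⟨c, hc⟩
      induction c using Quotient.inductionOn with | h x => ?_
      by_cases hx : ∃ w, r (f w) x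
      · obtain ⟨w, hw⟩ := hx
        refine ⟨Sum.inr ⟨Quotient.mk _ w, ?_⟩, ?_⟩
        · intro z hz
          have hz : (r.comap f ⊔ s) (p z) w := Quotient.exact hz
          rw [← comap_sup_map] at hz
          exact hc z (Quotient.sound (Setoid.trans' _ hz (hle hw)))
        · exact Subtype.ext (Quotient.sound (hle hw))
      · refine ⟨Sum.inl ⟨Quotient.mk _ x, ?_⟩, rfl⟩
        intro w hw
        exact hx ⟨w, Quotient.exact hw⟩
  have : Finite (Missed r f) := Subtype.finite
  have : Finite (Missed (r.comap f ⊔ s) p) := Subtype.finite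
  rw [← Nat.card_sum]
  exact (Nat.card_congr (Equiv.ofBijective F hF)).symm

variable {e : U → V} {f : W → V} {e' : Z → W} {g : Z → U}

theorem comap_map_square (he : Function.Injective e) (hf : Function.Injective f)
    (he' : Function.Injective e') (hsq : ∀ z, f (e' z) = e (g z))
    (hpb : ∀ w u, f w = e u → ∃ z, e' z = w ∧ g z = u) (q : Setoid U) :
    (q.map e).comap f = (q.comap g).map e' := by
  ext x y
  rw [Setoid.comap_rel, map_iff he, map_iff he']
  constructor
  · rintro (h | ⟨a, b, hab, ha, hb⟩)
    · exact Or.inl (hf h)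
    · obtain ⟨z, hz, rfl⟩ := hpb x a ha.symm
      obtain ⟨z', hz', rfl⟩ := hpb y b hb.symm
      exact Or.inr ⟨z, z', hab, hz, hz'⟩
  · rintro (rfl | ⟨a, b, hab, rfl, rfl⟩)
    · exact Or.inl rfl
    · exact Or.inr ⟨g a, g b, hab, (hsq a).symm, (hsq b).symm⟩

theorem card_missed_square (he : Function.Injective e) (hsq : ∀ z, f (e' z) = e (g z))
    (hpb : ∀ w u, f w = e u → ∃ z, e' z = w ∧ g z = u)
    (hcov : ∀ v, (∃ w, f w = v) ∨ ∃ u, e u = v) (q : Setoid U) :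
    Nat.card (Missed (q.map e) f) = Nat.card (Missed q g) := by
  have key : ∀ a b, (q.map e) (e a) (e b) ↔ q a b := by
    intro a b
    rw [map_iff he]
    constructor
    · rintro (h | ⟨a', b', h, h1, h2⟩)
      · rw [he h]
      · rwa [← he h1, ← he h2]
    · exact fun h => Or.inr ⟨a, b, h, rfl, rfl⟩
  let F : Missed q g → Missed (q.map e) f := fun c =>
    ⟨Quotient.map' e (fun a b h => (key a b).2 h) c.1, by
      obtain ⟨c, hc⟩ := c
      induction c using Quotient.inductionOn with
      | h x =>
        intro w hw
        have hw : (q.map e) (f w) (e x) := Quotient.exact hw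
        rw [map_iff he] at hw
        rcases hw with h | ⟨a, b, hab, h1, h2⟩
        · obtain ⟨z, -, hz⟩ := hpb _ _ h
          exact hc z (congrArg _ hz)
        · obtain ⟨z, -, hz⟩ := hpb _ _ h1.symm
          refine hc z (Quotient.sound ?_)
          rw [hz, ← he h2]
          exact hab⟩
  refine (Nat.card_congr (Equiv.ofBijective F ⟨?_, ?_⟩)).symm
  · rintro ⟨c, hc⟩ ⟨d, hd⟩ h
    induction c using Quotient.inductionOn with | h x => ?_
    induction d using Quotient.inductionOn with | h y => ?_
    have h : (q.map e) (e x) (e y) := Quotient.exact (congrArg Subtype.val h)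
    exact Subtype.ext (Quotient.sound ((key x y).1 h))
  · rintro ⟨c, hc⟩
    induction c using Quotient.inductionOn with | h x => ?_
    rcases hcov x with ⟨w, rfl⟩ | ⟨u, rfl⟩
    · exact (hc w rfl).elim
    · refine ⟨⟨Quotient.mk _ u, ?_⟩, rfl⟩
      intro z hz
      have hz : q (g z) u := Quotient.exact hz
      refine hc (e' z) (Quotient.sound ?_)
      rw [hsq]
      exact (key _ _).2 hz

end Setoid

/-- A partition diagram `k → l`, that is, a set partition of the disjoint union of the bottom row
`{1, …, k}` (`Sum.inl`) and the top row `{1', …, l'}` (`Sum.inr`), given as the equivalence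
relation of lying in the same block. -/
abbrev PartitionDiagram (k l : ℕ) : Type := Setoid (Fin k ⊕ Fin l)

namespace PartitionDiagram

/-- A partition diagram is a rook diagram if all blocks have size at most `2`, and distinct
vertices in the same block lie in distinct rows. -/
def IsRook {k l : ℕ} (D : PartitionDiagram k l) : Prop :=
  (∀ x, {y | D x y}.ncard ≤ 2) ∧ ∀ x y, D x y → x ≠ y → x.isLeft ≠ y.isLeft

/-- The identity diagram, with blocks `{i, i'}`. -/
@[reducible]
def one (k : ℕ) : PartitionDiagram k k := Setoid.ker (Sum.elim id id)

/-- The diagram with three rows obtained by stacking `D` on top of `D'`. The rows, from bottom to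
top, are `Fin k`, `Fin l` and `Fin m`. -/
@[reducible]
def stack {k l m : ℕ} (D : PartitionDiagram l m) (D' : PartitionDiagram k l) :
    Setoid (Fin k ⊕ Fin l ⊕ Fin m) :=
  D'.map (Sum.map id Sum.inl) ⊔ D.map Sum.inr

/-- The restriction `D ⋆ D'` of the stacked diagram to its bottom and top rows. -/
@[reducible]
def star {k l m : ℕ} (D : PartitionDiagram l m) (D' : PartitionDiagram k l) :
    PartitionDiagram k m :=
  (stack D D').comap (Sum.map id Sum.inr)

/-- The number `α(D, D')` of connected components of the stacked diagram all of whose vertices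
lie in the middle row. -/
def loops {k l m : ℕ} (D : PartitionDiagram l m) (D' : PartitionDiagram k l) : ℕ :=
  Nat.card {c : Quotient (stack D D') //
    ∀ x, Quotient.mk (stack D D') x = c → ∃ j : Fin l, x = Sum.inr (Sum.inl j)}

/-- The tensor product `D ⊗ D'`: juxtaposition, with `D'` on the right of `D`. -/
@[reducible]
def tensor {k l k' l' : ℕ} (D : PartitionDiagram k l) (D' : PartitionDiagram k' l') :
    PartitionDiagram (k + k') (l + l') :=
  D.map (Sum.map (Fin.castAdd k') (Fin.castAdd l')) ⊔ D'.map (Sum.map (Fin.natAdd k) (Fin.natAdd l))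

theorem loops_eq {k l m : ℕ} (D : PartitionDiagram l m) (D' : PartitionDiagram k l) :
    loops D D' =
      Nat.card (Missed (stack D D') (Sum.map id Sum.inr : Fin k ⊕ Fin m → _)) := by
  refine Nat.card_congr (Equiv.subtypeEquivRight fun c => ?_)
  constructor
  · intro h w hw
    obtain ⟨j, hj⟩ := h _ hw
    rcases w with w | w <;> simp at hj
  · rintro h (x | x | x) hx
    · exact (h (Sum.inl x) hx).elim
    · exact ⟨x, rfl⟩
    · exact (h (Sum.inr x) hx).elim

section Assoc

variable {a b c d : ℕ} (D₁ : PartitionDiagram c d) (D₂ : PartitionDiagram b c)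
  (D₃ : PartitionDiagram a b)

/-- The diagram with four rows obtained by stacking three diagrams. -/
@[reducible]
def stack₃ : Setoid (Fin a ⊕ Fin b ⊕ Fin c ⊕ Fin d) :=
  (stack D₁ D₂).map Sum.inr ⊔ D₃.map (Sum.map id Sum.inl)

theorem stack₃_eq : stack₃ D₁ D₂ D₃ =
    (stack D₂ D₃).map (Sum.map id (Sum.map id Sum.inl)) ⊔ D₁.map (Sum.inr ∘ Sum.inr) := by
  simp only [stack₃, stack, map_sup_setoid, map_map_setoid]
  rw [sup_comm, ← sup_assoc]
  congr 3
  funext x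
  rcases x with x | x <;> rfl

theorem left_aux :
    ((stack D₁ D₂).map Sum.inr).comap
        (Sum.map id (Sum.map id Sum.inr) : Fin a ⊕ Fin b ⊕ Fin d → Fin a ⊕ Fin b ⊕ Fin c ⊕ Fin d) =
      (star D₁ D₂).map Sum.inr := by
  refine comap_map_square Sum.inr_injective ?_ Sum.inr_injective ?_ ?_ _
  · exact Function.injective_id.sumMap (Function.injective_id.sumMap Sum.inr_injective)
  · intro z; rfl
  · rintro (w | w) u h
    · simp at h
    · exact ⟨w, rfl, Sum.inr_injective h⟩

theorem right_aux :
    ((stack D₂ D₃).map (Sum.map id (Sum.map id Sum.inl))).comap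
        (Sum.map id Sum.inr : Fin a ⊕ Fin c ⊕ Fin d → Fin a ⊕ Fin b ⊕ Fin c ⊕ Fin d) =
      (star D₂ D₃).map (Sum.map id Sum.inl) := by
  refine comap_map_square ?_ ?_ ?_ ?_ ?_ _
  · exact Function.injective_id.sumMap (Function.injective_id.sumMap Sum.inl_injective)
  · exact Function.injective_id.sumMap Sum.inr_injective
  · exact Function.injective_id.sumMap Sum.inl_injective
  · rintro (z | z) <;> rfl
  · rintro (w | w | w) (u | u | u) h <;> simp at h
    · subst h; exact ⟨Sum.inl w, rfl, rfl⟩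
    · subst h; exact ⟨Sum.inr w, rfl, rfl⟩

theorem stack_star_left :
    stack (star D₁ D₂) D₃ =
      (stack₃ D₁ D₂ D₃).comap (Sum.map id (Sum.map id Sum.inr)) := by
  have h : D₃.map (Sum.map id Sum.inl) =
      (D₃.map (Sum.map id Sum.inl : _ → Fin a ⊕ Fin b ⊕ Fin d)).map
        (Sum.map id (Sum.map id (Sum.inr : Fin d → Fin c ⊕ Fin d))) := by
    rw [map_map_setoid]; congr 1; funext x; rcases x with x | x <;> rfl
  rw [stack₃, h, comap_sup_map, left_aux, sup_comm, stack]

theorem stack_star_right :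
    stack D₁ (star D₂ D₃) =
      (stack₃ D₁ D₂ D₃).comap (Sum.map id Sum.inr) := by
  have h : D₁.map (Sum.inr ∘ Sum.inr) =
      (D₁.map (Sum.inr : _ → Fin a ⊕ Fin c ⊕ Fin d)).map
        (Sum.map id (Sum.inr : Fin c ⊕ Fin d → Fin b ⊕ Fin c ⊕ Fin d)) := by
    rw [map_map_setoid]; rfl
  rw [stack₃_eq, h, comap_sup_map, right_aux, stack]

theorem star_assoc : star (star D₁ D₂) D₃ = star D₁ (star D₂ D₃) := by
  ext x y
  rw [star, star.eq_1 D₁ (star D₂ D₃), stack_star_left, stack_star_right]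
  simp only [Setoid.comap_rel]
  rcases x with x | x <;> rcases y with y | y <;> rfl

theorem loops_left :
    loops D₁ D₂ + loops (star D₁ D₂) D₃ =
      Nat.card (Missed (stack₃ D₁ D₂ D₃)
        (Sum.map id (Sum.inr ∘ Sum.inr) : Fin a ⊕ Fin d → Fin a ⊕ Fin b ⊕ Fin c ⊕ Fin d)) := by
  have h : D₃.map (Sum.map id Sum.inl) =
      (D₃.map (Sum.map id Sum.inl : _ → Fin a ⊕ Fin b ⊕ Fin d)).map
        (Sum.map id (Sum.map id (Sum.inr : Fin d → Fin c ⊕ Fin d))) := by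
    rw [map_map_setoid]; congr 1; funext x; rcases x with x | x <;> rfl
  have hp : (Sum.map id (Sum.inr ∘ Sum.inr) : Fin a ⊕ Fin d → Fin a ⊕ Fin b ⊕ Fin c ⊕ Fin d) =
      Sum.map id (Sum.map id Sum.inr) ∘ Sum.map id Sum.inr := by
    funext x; rcases x with x | x <;> rfl
  rw [stack₃, h, hp, card_missed_sup_map, left_aux, loops_eq, loops_eq, stack.eq_1 (star D₁ D₂),
    sup_comm]
  congr 1
  refine (card_missed_square (e' := Sum.inr) Sum.inr_injective ?_ ?_ ?_ _).symm
  · intro z; rfl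
  · rintro (w | w) u h
    · simp at h
    · exact ⟨w, rfl, Sum.inr_injective h⟩
  · rintro (v | v)
    · exact Or.inl ⟨Sum.inl v, rfl⟩
    · exact Or.inr ⟨v, rfl⟩

theorem loops_right :
    loops D₂ D₃ + loops D₁ (star D₂ D₃) =
      Nat.card (Missed (stack₃ D₁ D₂ D₃)
        (Sum.map id (Sum.inr ∘ Sum.inr) : Fin a ⊕ Fin d → Fin a ⊕ Fin b ⊕ Fin c ⊕ Fin d)) := by
  have h : D₁.map (Sum.inr ∘ Sum.inr) =
      (D₁.map (Sum.inr : _ → Fin a ⊕ Fin c ⊕ Fin d)).map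
        (Sum.map id (Sum.inr : Fin c ⊕ Fin d → Fin b ⊕ Fin c ⊕ Fin d)) := by
    rw [map_map_setoid]; rfl
  have hp : (Sum.map id (Sum.inr ∘ Sum.inr) : Fin a ⊕ Fin d → Fin a ⊕ Fin b ⊕ Fin c ⊕ Fin d) =
      Sum.map id Sum.inr ∘ Sum.map id Sum.inr := by
    funext x; rcases x with x | x <;> rfl
  rw [stack₃_eq, h, hp, card_missed_sup_map, right_aux, loops_eq, loops_eq, stack.eq_1 D₁]
  congr 1
  refine (card_missed_square (e' := Sum.map id Sum.inl) ?_ ?_ ?_ ?_ _).symm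
  · exact Function.injective_id.sumMap (Function.injective_id.sumMap Sum.inl_injective)
  · rintro (z | z) <;> rfl
  · rintro (w | w | w) (u | u | u) h <;> simp at h
    · subst h; exact ⟨Sum.inl w, rfl, rfl⟩
    · subst h; exact ⟨Sum.inr w, rfl, rfl⟩
  · rintro (v | v | v | v)
    · exact Or.inl ⟨Sum.inl v, rfl⟩
    · exact Or.inr ⟨Sum.inr (Sum.inl v), rfl⟩
    · exact Or.inl ⟨Sum.inr (Sum.inl v), rfl⟩
    · exact Or.inl ⟨Sum.inr (Sum.inr v), rfl⟩

theorem loops_assoc :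
    loops D₁ D₂ + loops (star D₁ D₂) D₃ = loops D₂ D₃ + loops D₁ (star D₂ D₃) := by
  rw [loops_left, loops_right]

end Assoc

section One

variable {k l : ℕ} (D : PartitionDiagram k l)

theorem star_one : star D (one k) = D := by
  have hr : stack D (one k) ≤
      D.comap (Sum.elim Sum.inl id : Fin k ⊕ Fin k ⊕ Fin l → Fin k ⊕ Fin l) := by
    refine sup_le ?_ ?_ <;> rw [map_le_iff]
    · rintro (x | x) (y | y) h <;> (have h : x = y := h; subst h; exact Setoid.refl' _ _)
    · rintro x y h
      exact h
  have hm : ∀ i : Fin k, stack D (one k) (Sum.inl i) (Sum.inr (Sum.inl i)) := fun i =>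
    (le_sup_left : (one k).map _ ≤ stack D (one k))
      (map_rel (f := Sum.map id Sum.inl) (show one k (Sum.inl i) (Sum.inr i) from rfl))
  have hx : ∀ x : Fin k ⊕ Fin l, stack D (one k) (Sum.map id Sum.inr x) (Sum.inr x) := by
    rintro (x | x)
    · exact hm x
    · exact Setoid.refl' _ _
  ext x y
  constructor
  · intro h
    have := hr h
    rcases x with x | x <;> rcases y with y | y <;> exact this
  · intro h
    have : stack D (one k) (Sum.inr x) (Sum.inr y) :=
      (le_sup_right : D.map Sum.inr ≤ stack D (one k)) (map_rel h)
    exact (stack D (one k)).trans' (hx x)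
      ((stack D (one k)).trans' this ((stack D (one k)).symm' (hx y)))

theorem loops_one : loops D (one k) = 0 := by
  have hm : ∀ i : Fin k, stack D (one k) (Sum.inl i) (Sum.inr (Sum.inl i)) := fun i =>
    (le_sup_left : (one k).map _ ≤ stack D (one k))
      (map_rel (f := Sum.map id Sum.inl) (show one k (Sum.inl i) (Sum.inr i) from rfl))
  rw [loops_eq]
  have : IsEmpty (Missed (stack D (one k)) (Sum.map id Sum.inr : Fin k ⊕ Fin l → _)) := by
    refine ⟨?_⟩
    rintro ⟨c, hc⟩
    induction c using Quotient.inductionOn with | h x => ?_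
    rcases x with x | x | x
    · exact hc (Sum.inl x) rfl
    · exact hc (Sum.inl x) (Quotient.sound (hm x))
    · exact hc (Sum.inr x) rfl
  simp

theorem one_star : star (one l) D = D := by
  have hr : stack (one l) D ≤
      D.comap (Sum.elim Sum.inl (Sum.elim Sum.inr Sum.inr) :
        Fin k ⊕ Fin l ⊕ Fin l → Fin k ⊕ Fin l) := by
    refine sup_le ?_ ?_ <;> rw [map_le_iff]
    · rintro (x | x) (y | y) h <;> exact h
    · rintro (x | x) (y | y) h <;> (have h : x = y := h; subst h; exact Setoid.refl' _ _)
  have hm : ∀ i : Fin l, stack (one l) D (Sum.inr (Sum.inr i)) (Sum.inr (Sum.inl i)) := fun i =>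
    (le_sup_right : (one l).map _ ≤ stack (one l) D)
      (map_rel (f := Sum.inr) (show one l (Sum.inr i) (Sum.inl i) from rfl))
  have hx : ∀ x : Fin k ⊕ Fin l,
      stack (one l) D (Sum.map id Sum.inr x) (Sum.map id Sum.inl x) := by
    rintro (x | x)
    · exact Setoid.refl' _ _
    · exact hm x
  ext x y
  constructor
  · intro h
    have := hr h
    rcases x with x | x <;> rcases y with y | y <;> exact this
  · intro h
    have : stack (one l) D (Sum.map id Sum.inl x) (Sum.map id Sum.inl y) :=
      (le_sup_left : D.map (Sum.map id Sum.inl) ≤ stack (one l) D) (map_rel h)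
    exact (stack (one l) D).trans' (hx x)
      ((stack (one l) D).trans' this ((stack (one l) D).symm' (hx y)))

theorem one_loops : loops (one l) D = 0 := by
  have hm : ∀ i : Fin l, stack (one l) D (Sum.inr (Sum.inr i)) (Sum.inr (Sum.inl i)) := fun i =>
    (le_sup_right : (one l).map _ ≤ stack (one l) D)
      (map_rel (f := Sum.inr) (show one l (Sum.inr i) (Sum.inl i) from rfl))
  rw [loops_eq]
  have : IsEmpty (Missed (stack (one l) D) (Sum.map id Sum.inr : Fin k ⊕ Fin l → _)) := by
    refine ⟨?_⟩
    rintro ⟨c, hc⟩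
    induction c using Quotient.inductionOn with | h x => ?_
    rcases x with x | x | x
    · exact hc (Sum.inl x) rfl
    · exact hc (Sum.inr x) (Quotient.sound (hm x))
    · exact hc (Sum.inr x) rfl
  simp

end One

section Rook

variable {k l m : ℕ}

theorem isRook_iff (D : PartitionDiagram k l) :
    IsRook D ↔ (∀ i i' : Fin k, D (Sum.inl i) (Sum.inl i') → i = i') ∧
      ∀ j j' : Fin l, D (Sum.inr j) (Sum.inr j') → j = j' := by
  constructor
  · rintro ⟨-, h⟩
    constructor
    · intro i i' hi
      by_contra hne
      exact h _ _ hi (fun h' => hne (Sum.inl_injective h')) rfl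
    · intro i i' hi
      by_contra hne
      exact h _ _ hi (fun h' => hne (Sum.inr_injective h')) rfl
  · rintro ⟨h1, h2⟩
    have h : ∀ x y, D x y → x ≠ y → x.isLeft ≠ y.isLeft := by
      rintro (x | x) (y | y) hxy hne
      · exact (hne (congrArg _ (h1 _ _ hxy))).elim
      · simp
      · simp
      · exact (hne (congrArg _ (h2 _ _ hxy))).elim
    refine ⟨fun x => ?_, h⟩
    have hinj : Set.InjOn (Sum.isLeft : Fin k ⊕ Fin l → Bool) {y | D x y} := by
      intro y hy z hz hyz
      by_contra hne
      exact h y z (D.trans' (D.symm' hy) hz) hne hyz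
    calc {y | D x y}.ncard = (Sum.isLeft '' {y | D x y}).ncard := (hinj.ncard_image).symm
      _ ≤ (Set.univ : Set Bool).ncard := Set.ncard_le_ncard (Set.subset_univ _)
      _ = 2 := by simp

theorem isRook_one (k : ℕ) : IsRook (one k) := by
  rw [isRook_iff]
  exact ⟨fun _ _ h => h, fun _ _ h => h⟩

theorem IsRook.star {D : PartitionDiagram l m} {D' : PartitionDiagram k l} (hD : IsRook D)
    (hD' : IsRook D') : IsRook (star D D') := by
  rw [isRook_iff] at *
  obtain ⟨h1, h2⟩ := hD
  obtain ⟨h1', h2'⟩ := hD'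
  constructor
  · let φ : Fin k ⊕ Fin l ⊕ Fin m → Set (Fin k) :=
      Sum.elim (fun a => {a}) (Sum.elim (fun b => {a | D' (Sum.inl a) (Sum.inr b)})
        (fun c => {a | ∃ b, D' (Sum.inl a) (Sum.inr b) ∧ D (Sum.inl b) (Sum.inr c)}))
    have hle : stack D D' ≤ Setoid.ker φ := by
      have e1 : ∀ a b, D' (Sum.inl a) (Sum.inr b) →
          ({a} : Set (Fin k)) = {a | D' (Sum.inl a) (Sum.inr b)} := by
        intro a b h
        ext a'
        constructor
        · rintro rfl
          exact h
        · intro h'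
          exact h1' _ _ (D'.trans' h' (D'.symm' h))
      have e2 : ∀ b c, D (Sum.inl b) (Sum.inr c) → {a | D' (Sum.inl a) (Sum.inr b)} =
          {a | ∃ b, D' (Sum.inl a) (Sum.inr b) ∧ D (Sum.inl b) (Sum.inr c)} := by
        intro b c h
        ext a'
        constructor
        · intro h'
          exact ⟨b, h', h⟩
        · rintro ⟨b', h', h''⟩
          rwa [h1 _ _ (D.trans' h (D.symm' h''))]
      refine sup_le ?_ ?_ <;> rw [map_le_iff]
      · rintro (x | x) (y | y) h
        · rw [h1' _ _ h]
        · exact e1 _ _ h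
        · exact (e1 _ _ (D'.symm' h)).symm
        · rw [h2' _ _ h]
      · rintro (x | x) (y | y) h
        · rw [h1 _ _ h]
        · exact e2 _ _ h
        · exact (e2 _ _ (D.symm' h)).symm
        · rw [h2 _ _ h]
    intro i i' h
    have : ({i} : Set (Fin k)) = {i'} := hle h
    simpa using this
  · let φ : Fin k ⊕ Fin l ⊕ Fin m → Set (Fin m) :=
      Sum.elim (fun a => {c | ∃ b, D' (Sum.inl a) (Sum.inr b) ∧ D (Sum.inl b) (Sum.inr c)})
        (Sum.elim (fun b => {c | D (Sum.inl b) (Sum.inr c)}) (fun c => {c}))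
    have hle : stack D D' ≤ Setoid.ker φ := by
      have e1 : ∀ b c, D (Sum.inl b) (Sum.inr c) →
          {c | D (Sum.inl b) (Sum.inr c)} = ({c} : Set (Fin m)) := by
        intro b c h
        ext c'
        constructor
        · intro h'
          exact h2 _ _ (D.trans' (D.symm' h') h)
        · rintro rfl
          exact h
      have e2 : ∀ a b, D' (Sum.inl a) (Sum.inr b) →
          {c | ∃ b, D' (Sum.inl a) (Sum.inr b) ∧ D (Sum.inl b) (Sum.inr c)} =
            {c | D (Sum.inl b) (Sum.inr c)} := by
        intro a b h
        ext c'
        constructor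
        · rintro ⟨b', h', h''⟩
          have : b = b' := h2' _ _ (D'.trans' (D'.symm' h) h')
          subst this
          exact h''
        · intro h'
          exact ⟨b, h, h'⟩
      refine sup_le ?_ ?_ <;> rw [map_le_iff]
      · rintro (x | x) (y | y) h
        · rw [h1' _ _ h]
        · exact e2 _ _ h
        · exact (e2 _ _ (D'.symm' h)).symm
        · rw [h2' _ _ h]
      · rintro (x | x) (y | y) h
        · rw [h1 _ _ h]
        · exact e1 _ _ h
        · exact (e1 _ _ (D.symm' h)).symm
        · rw [h2 _ _ h]
    intro i i' h
    have : ({i} : Set (Fin m)) = {i'} := hle h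
    simpa using this

end Rook

end PartitionDiagram

/-- A rook diagram `k → l`. -/
abbrev RookDiagram (k l : ℕ) : Type := {D : PartitionDiagram k l // D.IsRook}

/-! ## The partition algebra and the rook algebra -/

/-- The underlying module of the partition algebra `P_k(t)`: formal `𝕜`-linear combinations of
partition diagrams `k → k`. -/
def PartitionAlgebra {𝕜 : Type u} [CommRing 𝕜] (_t : 𝕜) (k : ℕ) : Type u :=
  PartitionDiagram k k →₀ 𝕜

namespace PartitionAlgebra

variable {𝕜 : Type u} [CommRing 𝕜] (t : 𝕜) (k : ℕ)

instance : AddCommGroup (PartitionAlgebra t k) :=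
  inferInstanceAs (AddCommGroup (PartitionDiagram k k →₀ 𝕜))

instance : Module 𝕜 (PartitionAlgebra t k) :=
  inferInstanceAs (Module 𝕜 (PartitionDiagram k k →₀ 𝕜))

variable {k}

/-- A partition diagram as an element of the partition algebra. -/
def diagram (D : PartitionDiagram k k) : PartitionAlgebra t k := Finsupp.single D 1

variable {t}

theorem hom_ext {M : Type u} [AddCommGroup M] [Module 𝕜 M] {f g : PartitionAlgebra t k →ₗ[𝕜] M}
    (h : ∀ D, f (diagram t D) = g (diagram t D)) : f = g :=
  Finsupp.lhom_ext' fun D => LinearMap.ext_ring (h D)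

variable (t k)

/-- The multiplication of the partition algebra: the bilinear extension of
`D ∘ D' = t ^ α(D, D') D ⋆ D'`. -/
def mulMap : PartitionAlgebra t k →ₗ[𝕜] PartitionAlgebra t k →ₗ[𝕜] PartitionAlgebra t k :=
  Finsupp.linearCombination 𝕜 (fun D : PartitionDiagram k k =>
    (Finsupp.linearCombination 𝕜 (fun D' : PartitionDiagram k k =>
      t ^ PartitionDiagram.loops D D' • diagram t (PartitionDiagram.star D D')) :
        (PartitionDiagram k k →₀ 𝕜) →ₗ[𝕜] PartitionAlgebra t k))

instance : Mul (PartitionAlgebra t k) := ⟨fun x y => mulMap t k x y⟩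

instance : One (PartitionAlgebra t k) := ⟨diagram t (PartitionDiagram.one k)⟩

variable {t k}

theorem mul_def (x y : PartitionAlgebra t k) : x * y = mulMap t k x y := rfl

theorem diagram_mul_diagram (D D' : PartitionDiagram k k) :
    diagram t D * diagram t D' =
      t ^ PartitionDiagram.loops D D' • diagram t (PartitionDiagram.star D D') := by
  rw [mul_def]
  unfold mulMap
  have h1 := Finsupp.linearCombination_single 𝕜 (1 : 𝕜) D
    (v := fun D : PartitionDiagram k k =>
    (Finsupp.linearCombination 𝕜 (fun D' : PartitionDiagram k k =>
      t ^ PartitionDiagram.loops D D' • diagram t (PartitionDiagram.star D D')) :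
        (PartitionDiagram k k →₀ 𝕜) →ₗ[𝕜] PartitionAlgebra t k))
  have h2 := Finsupp.linearCombination_single 𝕜 (1 : 𝕜) D'
    (v := fun D' : PartitionDiagram k k =>
      t ^ PartitionDiagram.loops D D' • diagram t (PartitionDiagram.star D D'))
  rw [one_smul] at h1 h2
  rw [← h2]
  exact congrArg (fun f : (PartitionDiagram k k →₀ 𝕜) →ₗ[𝕜] PartitionAlgebra t k =>
    f (Finsupp.single D' 1)) h1

theorem mul_assoc' (x y z : PartitionAlgebra t k) : x * y * z = x * (y * z) := by
  have key : (mulMap t k).compr₂ (mulMap t k) =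
      ((LinearMap.llcomp 𝕜 (PartitionAlgebra t k) (PartitionAlgebra t k)
        (PartitionAlgebra t k)).comp (mulMap t k)).compl₂ (mulMap t k) := by
    refine hom_ext fun D₁ => hom_ext fun D₂ => hom_ext fun D₃ => ?_
    change (diagram t D₁ * diagram t D₂) * diagram t D₃ =
      diagram t D₁ * (diagram t D₂ * diagram t D₃)
    rw [diagram_mul_diagram, diagram_mul_diagram D₂]
    simp only [mul_def, map_smul, LinearMap.smul_apply]
    simp only [← mul_def, diagram_mul_diagram, smul_smul, ← pow_add,
      PartitionDiagram.loops_assoc, PartitionDiagram.star_assoc]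
  exact congrArg (fun f : PartitionAlgebra t k →ₗ[𝕜] PartitionAlgebra t k →ₗ[𝕜]
    PartitionAlgebra t k →ₗ[𝕜] PartitionAlgebra t k => f x y z) key

theorem one_mul' (x : PartitionAlgebra t k) : 1 * x = x := by
  have key : mulMap t k (diagram t (PartitionDiagram.one k)) = LinearMap.id := by
    refine hom_ext fun D => ?_
    change diagram t _ * diagram t D = diagram t D
    rw [diagram_mul_diagram, PartitionDiagram.one_loops, PartitionDiagram.one_star, pow_zero,
      one_smul]
  exact congrArg (fun f : PartitionAlgebra t k →ₗ[𝕜] PartitionAlgebra t k => f x) key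

theorem mul_one' (x : PartitionAlgebra t k) : x * 1 = x := by
  have key : (mulMap t k).flip (diagram t (PartitionDiagram.one k)) = LinearMap.id := by
    refine hom_ext fun D => ?_
    change diagram t D * diagram t _ = diagram t D
    rw [diagram_mul_diagram, PartitionDiagram.loops_one, PartitionDiagram.star_one, pow_zero,
      one_smul]
  exact congrArg (fun f : PartitionAlgebra t k →ₗ[𝕜] PartitionAlgebra t k => f x) key

instance : Ring (PartitionAlgebra t k) :=
  { (inferInstance : AddCommGroup (PartitionAlgebra t k)),
    (inferInstance : Mul (PartitionAlgebra t k)),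
    (inferInstance : One (PartitionAlgebra t k)) with
    mul_assoc := mul_assoc'
    one_mul := one_mul'
    mul_one := mul_one'
    left_distrib := fun x y z => map_add (mulMap t k x) y z
    right_distrib := fun x y z => LinearMap.map_add₂ (mulMap t k) x y z
    zero_mul := fun x => LinearMap.map_zero₂ (mulMap t k) x
    mul_zero := fun x => map_zero (mulMap t k x) }

instance : Algebra 𝕜 (PartitionAlgebra t k) :=
  Algebra.ofModule (fun a x y => LinearMap.map_smul₂ (mulMap t k) a x y)
    (fun a x y => map_smul (mulMap t k x) a y)

end PartitionAlgebra

/-- The rook algebra `R_k(t)`: the subalgebra of the partition algebra `P_k(t)` consisting of the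
linear combinations of rook diagrams `k → k`. -/
def rookAlgebra {𝕜 : Type u} [CommRing 𝕜] (t : 𝕜) (k : ℕ) :
    Subalgebra 𝕜 (PartitionAlgebra t k) :=
  (Submodule.span 𝕜
    (Set.range fun D : RookDiagram k k => PartitionAlgebra.diagram t D.1)).toSubalgebra
    (Submodule.subset_span ⟨⟨_, PartitionDiagram.isRook_one k⟩, rfl⟩)
    (by
      intro x y hx hy
      induction hx, hy using Submodule.span_induction₂ with
      | mem_mem x y hx hy =>
        obtain ⟨D, rfl⟩ := hx
        obtain ⟨D', rfl⟩ := hy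
        rw [PartitionAlgebra.diagram_mul_diagram]
        exact Submodule.smul_mem _ _ (Submodule.subset_span ⟨⟨_, D.2.star D'.2⟩, rfl⟩)
      | zero_left y hy => rw [zero_mul]; exact Submodule.zero_mem _
      | zero_right x hx => rw [mul_zero]; exact Submodule.zero_mem _
      | add_left x y z hx hy hz h1 h2 => rw [add_mul]; exact Submodule.add_mem _ h1 h2
      | add_right x y z hx hy hz h1 h2 => rw [mul_add]; exact Submodule.add_mem _ h1 h2
      | smul_left r x y hx hy h => rw [smul_mul_assoc]; exact Submodule.smul_mem _ _ h
      | smul_right r x y hx hy h => rw [mul_smul_comm]; exact Submodule.smul_mem _ _ h)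

/-! ## The rook category -/

/-- The generating morphisms `s : 2 → 2`, `η : 0 → 1` and `ε : 1 → 0` of the rook category. -/
inductive RookGen : ℕ → ℕ → Type
  | s : RookGen 2 2
  | eta : RookGen 0 1
  | eps : RookGen 1 0

/-- Expressions in the generators of the rook category. -/
abbrev RookTerm (𝕜 : Type u) (k l : ℕ) : Type u := Term 𝕜 RookGen k l

/-- The reflection in a horizontal line on generators. -/
def RookGen.flipH : ∀ {k l : ℕ}, RookGen k l → RookGen l k
  | _, _, .s => .s
  | _, _, .eta => .eps
  | _, _, .eps => .eta

/-- The involution `*` (reflection in a horizontal line): it reverses composition, preserves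
the tensor product, fixes `s` and exchanges `η` and `ε`. -/
def RookTerm.flipH {𝕜 : Type u} : ∀ {k l : ℕ}, RookTerm 𝕜 k l → RookTerm 𝕜 l k
  | _, _, .gen g => .gen g.flipH
  | _, _, .id k => .id k
  | _, _, .comp f g => .comp (flipH g) (flipH f)
  | _, _, .tensor f g => .tensor (flipH f) (flipH g)
  | _, _, .zero k l => .zero l k
  | _, _, .add f g => .add (flipH f) (flipH g)
  | _, _, .smul a f => .smul a (flipH f)

/-- The involution `♯` (reflection in a vertical line): it preserves composition, reverses
the tensor product, and fixes `s`, `η` and `ε`. -/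
def RookTerm.flipV {𝕜 : Type u} : ∀ {k l : ℕ}, RookTerm 𝕜 k l → RookTerm 𝕜 k l
  | _, _, .gen g => .gen g
  | _, _, .id k => .id k
  | _, _, .comp f g => .comp (flipV f) (flipV g)
  | _, _, .tensor f g =>
      Term.cast (Nat.add_comm _ _) (Nat.add_comm _ _) (.tensor (flipV g) (flipV f))
  | _, _, .zero k l => .zero k l
  | _, _, .add f g => .add (flipV f) (flipV g)
  | _, _, .smul a f => .smul a (flipV f)

section RookCategory

variable {𝕜 : Type u}

/-- The crossing `s`. -/
def sT : RookTerm 𝕜 2 2 := .gen .s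
/-- The morphism `η`. -/
def etaT : RookTerm 𝕜 0 1 := .gen .eta
/-- The morphism `ε`. -/
def epsT : RookTerm 𝕜 1 0 := .gen .eps
/-- The identity of the generating object. -/
def idT : RookTerm 𝕜 1 1 := .id 1
/-- The crossing of the first two of three strands, `s ⊗ 1`. -/
def sLeft : RookTerm 𝕜 3 3 := sT.tensor idT
/-- The crossing of the last two of three strands, `1 ⊗ s`. -/
def sRight : RookTerm 𝕜 3 3 := idT.tensor sT

/-- The defining relations of the rook category, up to reflections:
`s ∘ s = 1`, the braid relation, `s ∘ (η ⊗ 1) = 1 ⊗ η`, and `ε ∘ η = t 1_0`. -/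
inductive RookBaseRel (t : 𝕜) : ∀ ⦃k l : ℕ⦄, RookTerm 𝕜 k l → RookTerm 𝕜 k l → Prop
  | s_s : RookBaseRel t (sT.comp sT) (Term.id 2)
  | braid : RookBaseRel t (sRight.comp (sLeft.comp sRight)) (sLeft.comp (sRight.comp sLeft))
  | slide : RookBaseRel t (sT.comp (etaT.tensor idT : RookTerm 𝕜 1 2))
      (idT.tensor etaT : RookTerm 𝕜 1 2)
  | loop : RookBaseRel t (epsT.comp etaT) ((Term.id 0).smul t)

/-- The defining relations of the rook category: the relations `RookBaseRel` and their
transforms under `*` and `♯`. -/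
inductive RookRel (t : 𝕜) : ∀ ⦃k l : ℕ⦄, RookTerm 𝕜 k l → RookTerm 𝕜 k l → Prop
  | base {k l : ℕ} {f g : RookTerm 𝕜 k l} : RookBaseRel t f g → RookRel t f g
  | flipH {k l : ℕ} {f g : RookTerm 𝕜 k l} : RookBaseRel t f g →
      RookRel t (RookTerm.flipH f) (RookTerm.flipH g)
  | flipV {k l : ℕ} {f g : RookTerm 𝕜 k l} : RookBaseRel t f g →
      RookRel t (RookTerm.flipV f) (RookTerm.flipV g)
  | flipHV {k l : ℕ} {f g : RookTerm 𝕜 k l} : RookBaseRel t f g →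
      RookRel t (RookTerm.flipV (RookTerm.flipH f)) (RookTerm.flipV (RookTerm.flipH g))

variable [CommRing 𝕜]

/-- The rook category `R(t)`. -/
abbrev RookCategory (t : 𝕜) : Type := PresentedCategory (RookRel t)

/-- The object `k` of the rook category. -/
abbrev RookCategory.obj (t : 𝕜) (k : ℕ) : RookCategory t := PresentedCategory.obj k

end RookCategory

/-! ## Diagrams built from the generators -/

/-- Expressions built from the generators and identities by compositions and tensor products. -/
inductive RookWord : ℕ → ℕ → Type
  | gen {k l : ℕ} (g : RookGen k l) : RookWord k l
  | id (k : ℕ) : RookWord k k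
  | comp {k l m : ℕ} (v : RookWord l m) (w : RookWord k l) : RookWord k m
  | tensor {k l k' l' : ℕ} (v : RookWord k l) (w : RookWord k' l') : RookWord (k + k') (l + l')

/-- The diagram of a generator: `s` has blocks `{1, 2'}` and `{2, 1'}`, and the only vertex of
`η` and of `ε` is isolated. -/
@[reducible]
def RookGen.diagram : ∀ {k l : ℕ}, RookGen k l → PartitionDiagram k l
  | _, _, .s => Setoid.ker (Sum.elim Fin.rev id)
  | _, _, .eta => ⊥
  | _, _, .eps => ⊥

namespace RookWord

/-- A word as an expression in the generators. -/
def toTerm (𝕜 : Type u) : ∀ {k l : ℕ}, RookWord k l → RookTerm 𝕜 k l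
  | _, _, .gen g => .gen g
  | _, _, .id k => .id k
  | _, _, .comp v w => .comp (toTerm 𝕜 v) (toTerm 𝕜 w)
  | _, _, .tensor v w => .tensor (toTerm 𝕜 v) (toTerm 𝕜 w)

/-- The morphism of the rook category represented by a word. -/
def toHom {𝕜 : Type u} [CommRing 𝕜] (t : 𝕜) {k l : ℕ} (w : RookWord k l) :
    RookCategory.obj t k ⟶ RookCategory.obj t l :=
  PresentedCategory.homMk (RookRel t) (w.toTerm 𝕜)

/-- The partition diagram obtained by drawing a word, with closed components removed. -/
@[reducible]
def diagram : ∀ {k l : ℕ}, RookWord k l → PartitionDiagram k l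
  | _, _, .gen g => g.diagram
  | _, _, .id k => PartitionDiagram.one k
  | _, _, .comp v w => PartitionDiagram.star (diagram v) (diagram w)
  | _, _, .tensor v w => PartitionDiagram.tensor (diagram v) (diagram w)

/-- The number of closed components that are removed when drawing a word. -/
def loops : ∀ {k l : ℕ}, RookWord k l → ℕ
  | _, _, .gen _ => 0
  | _, _, .id _ => 0
  | _, _, .comp v w => loops v + loops w + PartitionDiagram.loops (diagram v) (diagram w)
  | _, _, .tensor v w => loops v + loops w

end RookWord

end RookTheory

namespace RookTheory

/-! ## Rook diagrams as partial bijections -/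

namespace PartitionDiagram

variable {k l m k' l' m' : ℕ}

/-! A rook diagram is a partial bijection between its two rows. Stacking composes partial
bijections, and a closed component is a middle vertex isolated on both sides. Linear combinations of
rook diagrams, composed with the factor `t ^ α`, therefore satisfy the axioms of a strict linear
monoidal category and the defining relations of `R(t)`. This yields an evaluation of morphisms
(`RookTerm.eval_eq_of_rel`, `PHom.eval`) that sends a word to a power of `t` times its diagram, so
morphisms drawing distinct diagrams without closed components are linearly independent.

Spanning rests on normal forms. Consider the last bottom vertex of a diagram. If it is isolated, the
diagram is a smaller one precomposed with the death of the last strand. If it is joined to the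
`j`-th top vertex, the diagram is a smaller one with a strand added on the right, followed by a
product of crossings (a cycle) that carries the last strand to position `j`. This peeling stops at
an empty bottom row, where only births remain. Each rook diagram thus has exactly one normal form
(`IsNormal.eq`, `exists_isNormal_diag`). The relations bring a generator composed with a normal form
back to a normal form up to a power of `t`: `Generated.comp_cycle` follows the carried strand
through the generator, and `IsNormal.generated_comp` is the induction on the bottom row. Hence every
word is a power of `t` times the normal form of its diagram (`RookWord.mk_toTerm`).

The exponent of `t` cannot be recovered from the morphism, for instance when `t = 1`. The rewriting
therefore takes place in `Tracked`, where one equality covers the morphism, the diagram and the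
number of closed components together.

Finally, basis vectors multiply exactly as diagrams do in the partition algebra, so the linear map
given on the basis is an injective algebra map whose image is the span of the rook diagrams. -/

theorem IsRook.eq_left {D : PartitionDiagram k l} (hD : IsRook D) {i i' : Fin k}
    (h : D (Sum.inl i) (Sum.inl i')) : i = i' :=
  ((isRook_iff D).1 hD).1 _ _ h

theorem IsRook.eq_right {D : PartitionDiagram k l} (hD : IsRook D) {j j' : Fin l}
    (h : D (Sum.inr j) (Sum.inr j')) : j = j' :=
  ((isRook_iff D).1 hD).2 _ _ h

/-- Within a row only equal vertices share a block, so a rook diagram carries no information beyond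
its bottom-to-top pairs. -/
theorem IsRook.ext {D D' : PartitionDiagram k l} (hD : IsRook D) (hD' : IsRook D')
    (h : ∀ i j, D (Sum.inl i) (Sum.inr j) ↔ D' (Sum.inl i) (Sum.inr j)) : D = D' := by
  ext x y
  rcases x with x | x <;> rcases y with y | y
  · exact ⟨fun e => by rw [hD.eq_left e], fun e => by rw [hD'.eq_left e]⟩
  · exact h x y
  · exact ⟨fun e => D'.symm' ((h _ _).1 (D.symm' e)), fun e => D.symm' ((h _ _).2 (D'.symm' e))⟩
  · exact ⟨fun e => by rw [hD.eq_right e], fun e => by rw [hD'.eq_right e]⟩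

/-- A connecting path in the stack could a priori zigzag. Since the blocks are pairs joining
different rows, it goes straight through one middle vertex. -/
theorem IsRook.star_iff {D : PartitionDiagram l m} {D' : PartitionDiagram k l} (hD : IsRook D)
    (hD' : IsRook D') (a : Fin k) (c : Fin m) :
    PartitionDiagram.star D D' (Sum.inl a) (Sum.inr c) ↔
      ∃ b, D' (Sum.inl a) (Sum.inr b) ∧ D (Sum.inl b) (Sum.inr c) := by
  constructor
  -- `φ` attaches to each vertex the set of top vertices reached from it by going straight up. It is
  -- constant on the blocks of both diagrams, hence on the components of the stack, and its value at
  -- `c` is `{c}`.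
  · let φ : Fin k ⊕ Fin l ⊕ Fin m → Set (Fin m) :=
      Sum.elim (fun a => {c | ∃ b, D' (Sum.inl a) (Sum.inr b) ∧ D (Sum.inl b) (Sum.inr c)})
        (Sum.elim (fun b => {c | D (Sum.inl b) (Sum.inr c)}) (fun c => {c}))
    have e1 : ∀ b c, D (Sum.inl b) (Sum.inr c) →
        {c | D (Sum.inl b) (Sum.inr c)} = ({c} : Set (Fin m)) := by
      intro b c h
      ext c'
      constructor
      · intro h'
        exact hD.eq_right (D.trans' (D.symm' h') h)
      · rintro rfl
        exact h
    have e2 : ∀ a b, D' (Sum.inl a) (Sum.inr b) →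
        {c | ∃ b, D' (Sum.inl a) (Sum.inr b) ∧ D (Sum.inl b) (Sum.inr c)} =
          {c | D (Sum.inl b) (Sum.inr c)} := by
      intro a b h
      ext c'
      constructor
      · rintro ⟨b', h', h''⟩
        obtain rfl : b = b' := hD'.eq_right (D'.trans' (D'.symm' h) h')
        exact h''
      · intro h'
        exact ⟨b, h, h'⟩
    have hle : stack D D' ≤ Setoid.ker φ := by
      refine sup_le ?_ ?_ <;> rw [map_le_iff]
      · rintro (x | x) (y | y) h
        · rw [hD'.eq_left h]
        · exact e2 _ _ h
        · exact (e2 _ _ (D'.symm' h)).symm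
        · rw [hD'.eq_right h]
      · rintro (x | x) (y | y) h
        · rw [hD.eq_left h]
        · exact e1 _ _ h
        · exact (e1 _ _ (D.symm' h)).symm
        · rw [hD.eq_right h]
    intro h
    have : {c | ∃ b, D' (Sum.inl a) (Sum.inr b) ∧ D (Sum.inl b) (Sum.inr c)} = {c} := hle h
    have hc : c ∈ ({c} : Set (Fin m)) := rfl
    rwa [← this] at hc
  · rintro ⟨b, h1, h2⟩
    have h1 : stack D D' (Sum.inl a) (Sum.inr (Sum.inl b)) :=
      (le_sup_left : D'.map (Sum.map id Sum.inl) ≤ stack D D') (map_rel h1)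
    have h2 : stack D D' (Sum.inr (Sum.inl b)) (Sum.inr (Sum.inr c)) :=
      (le_sup_right : D.map Sum.inr ≤ stack D D') (map_rel h2)
    exact (stack D D').trans' h1 h2

/-- The loops of a stack of rook diagrams are the middle vertices isolated on both sides. -/
theorem IsRook.loops_eq_card {D : PartitionDiagram l m} {D' : PartitionDiagram k l}
    (hD : IsRook D) (hD' : IsRook D') :
    loops D D' = Nat.card {j : Fin l // (∀ i, ¬ D' (Sum.inl i) (Sum.inr j)) ∧
      ∀ c, ¬ D (Sum.inl j) (Sum.inr c)} := by
  -- A middle vertex isolated on both sides is a whole component: the predicate of being that vertex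
  -- is constant on all blocks.
  have key : ∀ j : Fin l, (∀ i, ¬ D' (Sum.inl i) (Sum.inr j)) →
      (∀ c, ¬ D (Sum.inl j) (Sum.inr c)) → ∀ x, stack D D' x (Sum.inr (Sum.inl j)) →
        x = Sum.inr (Sum.inl j) := by
    intro j h1 h2 x hx
    have hle : stack D D' ≤ Setoid.ker (fun x => x = Sum.inr (Sum.inl j)) := by
      refine sup_le ?_ ?_ <;> rw [map_le_iff]
      · rintro (x | x) (y | y) h
        · rw [hD'.eq_left h]
        · refine propext ⟨fun e => by simp at e, fun e => ?_⟩
          obtain rfl := Sum.inl_injective (Sum.inr_injective e)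
          exact (h1 _ h).elim
        · refine propext ⟨fun e => ?_, fun e => by simp at e⟩
          obtain rfl := Sum.inl_injective (Sum.inr_injective e)
          exact (h1 _ (D'.symm' h)).elim
        · rw [hD'.eq_right h]
      · rintro (x | x) (y | y) h
        · rw [hD.eq_left h]
        · refine propext ⟨fun e => ?_, fun e => by simp at e⟩
          obtain rfl := Sum.inl_injective (Sum.inr_injective e)
          exact (h2 _ h).elim
        · refine propext ⟨fun e => by simp at e, fun e => ?_⟩
          obtain rfl := Sum.inl_injective (Sum.inr_injective e)
          exact (h2 _ (D.symm' h)).elim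
        · rw [hD.eq_right h]
    have : (x = Sum.inr (Sum.inl j)) = (Sum.inr (Sum.inl j) = Sum.inr (Sum.inl j)) := hle hx
    rw [this]
  symm
  -- Such a vertex is sent to its component. For surjectivity, a vertex of a closed component cannot
  -- be joined to either outer row, since this would put an outer vertex in the component.
  refine Nat.card_congr (Equiv.ofBijective (fun j => ⟨Quotient.mk _ (Sum.inr (Sum.inl j.1)),
    fun x hx => ⟨j.1, key j.1 j.2.1 j.2.2 x (Quotient.exact hx)⟩⟩) ⟨?_, ?_⟩)
  · intro j j' h
    have h := key j'.1 j'.2.1 j'.2.2 _ (Quotient.exact (congrArg Subtype.val h))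
    exact Subtype.ext (Sum.inl_injective (Sum.inr_injective h))
  · rintro ⟨c, hc⟩
    induction c using Quotient.inductionOn with | h x => ?_
    obtain ⟨j, rfl⟩ := hc x rfl
    refine ⟨⟨j, fun i hi => ?_, fun c h => ?_⟩, rfl⟩
    · have : stack D D' (Sum.inl i) (Sum.inr (Sum.inl j)) :=
        (le_sup_left : D'.map (Sum.map id Sum.inl) ≤ stack D D') (map_rel hi)
      obtain ⟨j', hj'⟩ := hc _ (Quotient.sound this)
      simp at hj'
    · have : stack D D' (Sum.inr (Sum.inl j)) (Sum.inr (Sum.inr c)) :=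
        (le_sup_right : D.map Sum.inr ≤ stack D D') (map_rel h)
      obtain ⟨j', hj'⟩ := hc _ (Quotient.sound ((stack D D').symm' this))
      simp at hj'

/-! ### Juxtaposition of diagrams -/

section Tensor

variable (D : PartitionDiagram k l) (D' : PartitionDiagram k' l')

/-- The component of a vertex of a juxtaposition, as a component of one of its parts. -/
def tensorClass : Fin (k + k') ⊕ Fin (l + l') → Quotient D ⊕ Quotient D' :=
  Sum.elim
    (Fin.addCases (fun i => Sum.inl (Quotient.mk D (Sum.inl i)))
      (fun i => Sum.inr (Quotient.mk D' (Sum.inl i))))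
    (Fin.addCases (fun i => Sum.inl (Quotient.mk D (Sum.inr i)))
      (fun i => Sum.inr (Quotient.mk D' (Sum.inr i))))

theorem tensorClass_left (x : Fin k ⊕ Fin l) :
    tensorClass D D' (Sum.map (Fin.castAdd k') (Fin.castAdd l') x) =
      Sum.inl (Quotient.mk D x) := by
  rcases x with x | x <;> simp [tensorClass]

theorem tensorClass_right (x : Fin k' ⊕ Fin l') :
    tensorClass D D' (Sum.map (Fin.natAdd k) (Fin.natAdd l) x) = Sum.inr (Quotient.mk D' x) := by
  rcases x with x | x <;> simp [tensorClass]

/-- Each generating pair of the juxtaposition lies inside a single part, so `tensorClass` is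
constant on blocks. This is the upper bound from which the next three criteria are read off. -/
theorem tensor_le : tensor D D' ≤ Setoid.ker (tensorClass D D') := by
  refine sup_le ?_ ?_ <;> rw [map_le_iff] <;> intro x y h
  · change tensorClass _ _ _ = tensorClass _ _ _
    rw [tensorClass_left, tensorClass_left]
    exact congrArg _ (Quotient.sound h)
  · change tensorClass _ _ _ = tensorClass _ _ _
    rw [tensorClass_right, tensorClass_right]
    exact congrArg _ (Quotient.sound h)

theorem tensor_left_iff (x y : Fin k ⊕ Fin l) :
    tensor D D' (Sum.map (Fin.castAdd k') (Fin.castAdd l') x)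
      (Sum.map (Fin.castAdd k') (Fin.castAdd l') y) ↔ D x y := by
  constructor
  · intro h
    have h : tensorClass _ _ _ = tensorClass _ _ _ := tensor_le D D' h
    rw [tensorClass_left, tensorClass_left] at h
    exact Quotient.exact (Sum.inl_injective h)
  · intro h
    exact (le_sup_left : D.map _ ≤ tensor D D') (map_rel h)

theorem tensor_right_iff (x y : Fin k' ⊕ Fin l') :
    tensor D D' (Sum.map (Fin.natAdd k) (Fin.natAdd l) x)
      (Sum.map (Fin.natAdd k) (Fin.natAdd l) y) ↔ D' x y := by
  constructor
  · intro h
    have h : tensorClass _ _ _ = tensorClass _ _ _ := tensor_le D D' h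
    rw [tensorClass_right, tensorClass_right] at h
    exact Quotient.exact (Sum.inr_injective h)
  · intro h
    exact (le_sup_right : D'.map _ ≤ tensor D D') (map_rel h)

theorem not_tensor_left_right (x : Fin k ⊕ Fin l) (y : Fin k' ⊕ Fin l') :
    ¬ tensor D D' (Sum.map (Fin.castAdd k') (Fin.castAdd l') x)
      (Sum.map (Fin.natAdd k) (Fin.natAdd l) y) := by
  intro h
  have h : tensorClass _ _ _ = tensorClass _ _ _ := tensor_le D D' h
  rw [tensorClass_left, tensorClass_right] at h
  simp at h

variable {D D'}

theorem IsRook.tensor (hD : IsRook D) (hD' : IsRook D') :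
    IsRook (PartitionDiagram.tensor D D') := by
  rw [isRook_iff]
  constructor
  · intro i i'
    refine Fin.addCases (fun i => ?_) (fun i => ?_) i <;>
      refine Fin.addCases (fun i' => ?_) (fun i' => ?_) i' <;> intro h
    · rw [hD.eq_left ((tensor_left_iff D D' (Sum.inl i) (Sum.inl i')).1 h)]
    · exact (not_tensor_left_right D D' (Sum.inl i) (Sum.inl i') h).elim
    · exact (not_tensor_left_right D D' (Sum.inl i') (Sum.inl i) (Setoid.symm' _ h)).elim
    · rw [hD'.eq_left ((tensor_right_iff D D' (Sum.inl i) (Sum.inl i')).1 h)]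
  · intro i i'
    refine Fin.addCases (fun i => ?_) (fun i => ?_) i <;>
      refine Fin.addCases (fun i' => ?_) (fun i' => ?_) i' <;> intro h
    · rw [hD.eq_right ((tensor_left_iff D D' (Sum.inr i) (Sum.inr i')).1 h)]
    · exact (not_tensor_left_right D D' (Sum.inr i) (Sum.inr i') h).elim
    · exact (not_tensor_left_right D D' (Sum.inr i') (Sum.inr i) (Setoid.symm' _ h)).elim
    · rw [hD'.eq_right ((tensor_right_iff D D' (Sum.inr i) (Sum.inr i')).1 h)]

end Tensor

end PartitionDiagram

/-! ### Composition and juxtaposition of partial bijections -/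

namespace RookDiagram

variable {k l m n k' l' m' k'' l'' : ℕ}

/-- The relation of being joined, between the bottom and the top row of a rook diagram. -/
def rel (D : RookDiagram k l) (i : Fin k) (j : Fin l) : Prop := D.1 (Sum.inl i) (Sum.inr j)

theorem rel_ext {D D' : RookDiagram k l} (h : ∀ i j, D.rel i j ↔ D'.rel i j) : D = D' :=
  Subtype.ext (D.2.ext D'.2 h)

theorem rel_inj {D : RookDiagram k l} {i i' : Fin k} {j : Fin l} (h : D.rel i j)
    (h' : D.rel i' j) : i = i' :=
  D.2.eq_left (D.1.trans' h (D.1.symm' h'))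

theorem rel_fun {D : RookDiagram k l} {i : Fin k} {j j' : Fin l} (h : D.rel i j)
    (h' : D.rel i j') : j = j' :=
  D.2.eq_right (D.1.trans' (D.1.symm' h) h')

/-- The identity rook diagram. -/
def one (k : ℕ) : RookDiagram k k := ⟨PartitionDiagram.one k, PartitionDiagram.isRook_one k⟩

/-- The composition of rook diagrams, without the count of closed components. -/
def star (D : RookDiagram l m) (D' : RookDiagram k l) : RookDiagram k m :=
  ⟨PartitionDiagram.star D.1 D'.1, D.2.star D'.2⟩

/-- The number of closed components of a composition of rook diagrams. -/
def loops (D : RookDiagram l m) (D' : RookDiagram k l) : ℕ := PartitionDiagram.loops D.1 D'.1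

/-- The juxtaposition of rook diagrams. -/
def tensor (D : RookDiagram k l) (D' : RookDiagram k' l') : RookDiagram (k + k') (l + l') :=
  ⟨PartitionDiagram.tensor D.1 D'.1, D.2.tensor D'.2⟩

theorem rel_one (i j : Fin k) : (one k).rel i j ↔ i = j := Iff.rfl

theorem rel_star (D : RookDiagram l m) (D' : RookDiagram k l) (a : Fin k) (c : Fin m) :
    (D.star D').rel a c ↔ ∃ b, D'.rel a b ∧ D.rel b c :=
  D.2.star_iff D'.2 a c

theorem rel_tensor_left (D : RookDiagram k l) (D' : RookDiagram k' l') (i : Fin k) (j : Fin l) :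
    (D.tensor D').rel (Fin.castAdd k' i) (Fin.castAdd l' j) ↔ D.rel i j :=
  PartitionDiagram.tensor_left_iff D.1 D'.1 (Sum.inl i) (Sum.inr j)

theorem rel_tensor_right (D : RookDiagram k l) (D' : RookDiagram k' l') (i : Fin k')
    (j : Fin l') : (D.tensor D').rel (Fin.natAdd k i) (Fin.natAdd l j) ↔ D'.rel i j :=
  PartitionDiagram.tensor_right_iff D.1 D'.1 (Sum.inl i) (Sum.inr j)

theorem not_rel_tensor_left_right (D : RookDiagram k l) (D' : RookDiagram k' l') (i : Fin k)
    (j : Fin l') : ¬ (D.tensor D').rel (Fin.castAdd k' i) (Fin.natAdd l j) :=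
  PartitionDiagram.not_tensor_left_right D.1 D'.1 (Sum.inl i) (Sum.inr j)

theorem not_rel_tensor_right_left (D : RookDiagram k l) (D' : RookDiagram k' l') (i : Fin k')
    (j : Fin l) : ¬ (D.tensor D').rel (Fin.natAdd k i) (Fin.castAdd l' j) := fun h =>
  PartitionDiagram.not_tensor_left_right D.1 D'.1 (Sum.inr j) (Sum.inl i) (Setoid.symm' _ h)

/-- Positions are compared as natural numbers, so that associativity and unit laws across different
presentations of the same row size become arithmetic, and so that the condition is visibly
decidable. -/
theorem rel_tensor (D : RookDiagram k l) (D' : RookDiagram k' l') (i : Fin (k + k'))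
    (j : Fin (l + l')) : (D.tensor D').rel i j ↔
      (∃ a b, D.rel a b ∧ (a : ℕ) = i ∧ (b : ℕ) = j) ∨
        ∃ a b, D'.rel a b ∧ k + a = i ∧ l + b = j := by
  refine Fin.addCases (fun i => ?_) (fun i => ?_) i <;>
    refine Fin.addCases (fun j => ?_) (fun j => ?_) j
  · rw [rel_tensor_left]
    constructor
    · exact fun h => Or.inl ⟨i, j, h, rfl, rfl⟩
    · rintro (⟨a, b, h, h1, h2⟩ | ⟨a, b, h, h1, h2⟩)
      · obtain rfl : a = i := Fin.ext h1
        obtain rfl : b = j := Fin.ext h2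
        exact h
      · have := i.2
        simp at h1
        omega
  · refine iff_of_false (not_rel_tensor_left_right _ _ _ _) ?_
    rintro (⟨a, b, h, h1, h2⟩ | ⟨a, b, h, h1, h2⟩)
    · have := b.2
      simp at h2
      omega
    · have := i.2
      simp at h1
      omega
  · refine iff_of_false (not_rel_tensor_right_left _ _ _ _) ?_
    rintro (⟨a, b, h, h1, h2⟩ | ⟨a, b, h, h1, h2⟩)
    · have := a.2
      simp at h1
      omega
    · have := j.2
      simp at h2
      omega
  · rw [rel_tensor_right]
    constructor
    · exact fun h => Or.inr ⟨i, j, h, rfl, rfl⟩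
    · rintro (⟨a, b, h, h1, h2⟩ | ⟨a, b, h, h1, h2⟩)
      · have := a.2
        simp at h1
        omega
      · obtain rfl : a = i := Fin.ext (by simpa using h1)
        obtain rfl : b = j := Fin.ext (by simpa using h2)
        exact h

theorem loops_eq_card (D : RookDiagram l m) (D' : RookDiagram k l) :
    D.loops D' = Nat.card {j : Fin l // (∀ i, ¬ D'.rel i j) ∧ ∀ c, ¬ D.rel j c} :=
  D.2.loops_eq_card D'.2

theorem loops_eq_zero {D : RookDiagram l m} {D' : RookDiagram k l}
    (h : ∀ j, (∃ i, D'.rel i j) ∨ ∃ c, D.rel j c) : D.loops D' = 0 := by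
  rw [loops_eq_card]
  have : IsEmpty {j : Fin l // (∀ i, ¬ D'.rel i j) ∧ ∀ c, ¬ D.rel j c} := by
    refine ⟨fun ⟨j, h1, h2⟩ => ?_⟩
    rcases h j with ⟨i, hi⟩ | ⟨c, hc⟩
    · exact h1 _ hi
    · exact h2 _ hc
  simp

theorem star_assoc (D₁ : RookDiagram m n) (D₂ : RookDiagram l m) (D₃ : RookDiagram k l) :
    (D₁.star D₂).star D₃ = D₁.star (D₂.star D₃) :=
  Subtype.ext (PartitionDiagram.star_assoc _ _ _)

theorem loops_assoc (D₁ : RookDiagram m n) (D₂ : RookDiagram l m) (D₃ : RookDiagram k l) :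
    D₁.loops D₂ + (D₁.star D₂).loops D₃ = D₂.loops D₃ + D₁.loops (D₂.star D₃) :=
  PartitionDiagram.loops_assoc _ _ _

theorem one_star (D : RookDiagram k l) : (one l).star D = D :=
  Subtype.ext (PartitionDiagram.one_star _)

theorem star_one (D : RookDiagram k l) : D.star (one k) = D :=
  Subtype.ext (PartitionDiagram.star_one _)

theorem one_loops (D : RookDiagram k l) : (one l).loops D = 0 := PartitionDiagram.one_loops _

theorem loops_one (D : RookDiagram k l) : D.loops (one k) = 0 := PartitionDiagram.loops_one _

theorem tensor_one_one (k l : ℕ) : (one k).tensor (one l) = one (k + l) := by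
  refine rel_ext fun i j => ?_
  rw [rel_tensor]
  simp only [rel_one]
  constructor
  · rintro (⟨a, b, rfl, h1, h2⟩ | ⟨a, b, rfl, h1, h2⟩) <;> exact Fin.ext (h1.symm.trans h2)
  · rintro rfl
    refine Fin.addCases (fun i => ?_) (fun i => ?_) i
    · exact Or.inl ⟨i, i, rfl, rfl, rfl⟩
    · exact Or.inr ⟨i, i, rfl, rfl, rfl⟩

/-- A path through the middle row never leaves the part in which it starts, so all mixed cases are
contradictory. -/
theorem star_tensor_star (D₁ : RookDiagram l m) (D₂ : RookDiagram k l)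
    (D₁' : RookDiagram l' m') (D₂' : RookDiagram k' l') :
    (D₁.tensor D₁').star (D₂.tensor D₂') = (D₁.star D₂).tensor (D₁'.star D₂') := by
  refine rel_ext fun i j => ?_
  rw [rel_star]
  constructor
  · rintro ⟨b, h1, h2⟩
    revert h1 h2
    refine Fin.addCases (fun i => ?_) (fun i => ?_) i <;>
      refine Fin.addCases (fun j => ?_) (fun j => ?_) j <;>
      refine Fin.addCases (fun b => ?_) (fun b => ?_) b <;>
      intro h1 h2
    · rw [rel_tensor_left] at h1 h2 ⊢
      exact (rel_star _ _ _ _).2 ⟨b, h1, h2⟩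
    · exact (not_rel_tensor_left_right _ _ _ _ h1).elim
    · exact (not_rel_tensor_left_right _ _ _ _ h2).elim
    · exact (not_rel_tensor_left_right _ _ _ _ h1).elim
    · exact (not_rel_tensor_right_left _ _ _ _ h1).elim
    · exact (not_rel_tensor_right_left _ _ _ _ h2).elim
    · exact (not_rel_tensor_right_left _ _ _ _ h1).elim
    · rw [rel_tensor_right] at h1 h2 ⊢
      exact (rel_star _ _ _ _).2 ⟨b, h1, h2⟩
  · refine Fin.addCases (fun i => ?_) (fun i => ?_) i <;>
      refine Fin.addCases (fun j => ?_) (fun j => ?_) j <;> intro h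
    · rw [rel_tensor_left, rel_star] at h
      obtain ⟨b, h1, h2⟩ := h
      exact ⟨Fin.castAdd _ b, (rel_tensor_left _ _ _ _).2 h1, (rel_tensor_left _ _ _ _).2 h2⟩
    · exact (not_rel_tensor_left_right _ _ _ _ h).elim
    · exact (not_rel_tensor_right_left _ _ _ _ h).elim
    · rw [rel_tensor_right, rel_star] at h
      obtain ⟨b, h1, h2⟩ := h
      exact ⟨Fin.natAdd _ b, (rel_tensor_right _ _ _ _).2 h1, (rel_tensor_right _ _ _ _).2 h2⟩

theorem exists_rel_tensor_left (D : RookDiagram k l) (D' : RookDiagram k' l') (i : Fin k) :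
    (∃ j, (D.tensor D').rel (Fin.castAdd k' i) j) ↔ ∃ j, D.rel i j := by
  constructor
  · rintro ⟨j, h⟩
    revert h
    refine Fin.addCases (fun j => ?_) (fun j => ?_) j <;> intro h
    · exact ⟨j, (rel_tensor_left _ _ _ _).1 h⟩
    · exact (not_rel_tensor_left_right _ _ _ _ h).elim
  · rintro ⟨j, h⟩
    exact ⟨_, (rel_tensor_left _ _ _ _).2 h⟩

theorem exists_rel_tensor_right (D : RookDiagram k l) (D' : RookDiagram k' l') (i : Fin k') :
    (∃ j, (D.tensor D').rel (Fin.natAdd k i) j) ↔ ∃ j, D'.rel i j := by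
  constructor
  · rintro ⟨j, h⟩
    revert h
    refine Fin.addCases (fun j => ?_) (fun j => ?_) j <;> intro h
    · exact (not_rel_tensor_right_left _ _ _ _ h).elim
    · exact ⟨j, (rel_tensor_right _ _ _ _).1 h⟩
  · rintro ⟨j, h⟩
    exact ⟨_, (rel_tensor_right _ _ _ _).2 h⟩

theorem exists_tensor_left_rel (D : RookDiagram k l) (D' : RookDiagram k' l') (j : Fin l) :
    (∃ i, (D.tensor D').rel i (Fin.castAdd l' j)) ↔ ∃ i, D.rel i j := by
  constructor
  · rintro ⟨i, h⟩
    revert h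
    refine Fin.addCases (fun i => ?_) (fun i => ?_) i <;> intro h
    · exact ⟨i, (rel_tensor_left _ _ _ _).1 h⟩
    · exact (not_rel_tensor_right_left _ _ _ _ h).elim
  · rintro ⟨j, h⟩
    exact ⟨_, (rel_tensor_left _ _ _ _).2 h⟩

theorem exists_tensor_right_rel (D : RookDiagram k l) (D' : RookDiagram k' l') (j : Fin l') :
    (∃ i, (D.tensor D').rel i (Fin.natAdd l j)) ↔ ∃ i, D'.rel i j := by
  constructor
  · rintro ⟨i, h⟩
    revert h
    refine Fin.addCases (fun i => ?_) (fun i => ?_) i <;> intro h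
    · exact (not_rel_tensor_left_right _ _ _ _ h).elim
    · exact ⟨i, (rel_tensor_right _ _ _ _).1 h⟩
  · rintro ⟨j, h⟩
    exact ⟨_, (rel_tensor_right _ _ _ _).2 h⟩

/-- The middle row splits into the middle rows of the two parts, and being isolated on both sides is
tested within one part. -/
theorem loops_tensor (D₁ : RookDiagram l m) (D₂ : RookDiagram k l)
    (D₁' : RookDiagram l' m') (D₂' : RookDiagram k' l') :
    (D₁.tensor D₁').loops (D₂.tensor D₂') = D₁.loops D₂ + D₁'.loops D₂' := by
  simp only [loops_eq_card]
  rw [← Nat.card_sum]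
  let p : Fin l ⊕ Fin l' → Prop := fun x =>
    (∀ i, ¬ (D₂.tensor D₂').rel i (finSumFinEquiv x)) ∧
      ∀ c, ¬ (D₁.tensor D₁').rel (finSumFinEquiv x) c
  refine Nat.card_congr (((Equiv.subtypeEquiv (p := p) finSumFinEquiv fun _ => Iff.rfl).symm.trans
    Equiv.subtypeSum).trans (Equiv.sumCongr (Equiv.subtypeEquivRight fun j => ?_)
      (Equiv.subtypeEquivRight fun j => ?_)))
  · simp only [p, finSumFinEquiv_apply_left, ← not_exists, exists_tensor_left_rel,
      exists_rel_tensor_left]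
  · simp only [p, finSumFinEquiv_apply_right, ← not_exists, exists_tensor_right_rel,
      exists_rel_tensor_right]

/-- Transport of a rook diagram along equalities of the sizes of its rows. -/
def cast (hk : k = k') (hl : l = l') (D : RookDiagram k l) : RookDiagram k' l' := hl ▸ hk ▸ D

theorem rel_cast (hk : k = k') (hl : l = l') (D : RookDiagram k l) (i : Fin k') (j : Fin l') :
    (D.cast hk hl).rel i j ↔ D.rel (Fin.cast hk.symm i) (Fin.cast hl.symm j) := by
  subst hk hl
  rfl

theorem tensor_assoc (D : RookDiagram k l) (D' : RookDiagram k' l') (D'' : RookDiagram k'' l'') :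
    ((D.tensor D').tensor D'').cast (Nat.add_assoc k k' k'') (Nat.add_assoc l l' l'') =
      D.tensor (D'.tensor D'') := by
  refine rel_ext fun i j => ?_
  rw [rel_cast, rel_tensor, rel_tensor]
  simp only [rel_tensor, Fin.val_cast]
  constructor
  · rintro (⟨a, b, ⟨c, d, h, h1, h2⟩ | ⟨c, d, h, h1, h2⟩, h3, h4⟩ | ⟨a, b, h, h1, h2⟩)
    · exact Or.inl ⟨c, d, h, h1.trans h3, h2.trans h4⟩
    · exact Or.inr ⟨Fin.castAdd _ c, Fin.castAdd _ d, Or.inl ⟨c, d, h, rfl, rfl⟩,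
        h1.trans h3, h2.trans h4⟩
    · exact Or.inr ⟨Fin.natAdd _ a, Fin.natAdd _ b, Or.inr ⟨a, b, h, rfl, rfl⟩,
        by simp; omega, by simp; omega⟩
  · rintro (⟨c, d, h, h1, h2⟩ | ⟨a, b, ⟨c, d, h, h1, h2⟩ | ⟨c, d, h, h1, h2⟩, h3, h4⟩)
    · exact Or.inl ⟨Fin.castAdd _ c, Fin.castAdd _ d, Or.inl ⟨c, d, h, rfl, rfl⟩, h1, h2⟩
    · exact Or.inl ⟨Fin.natAdd _ c, Fin.natAdd _ d, Or.inr ⟨c, d, h, rfl, rfl⟩,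
        by simp; omega, by simp; omega⟩
    · exact Or.inr ⟨c, d, h, by omega, by omega⟩

theorem one_tensor (D : RookDiagram k l) :
    ((one 0).tensor D).cast (Nat.zero_add k) (Nat.zero_add l) = D := by
  refine rel_ext fun i j => ?_
  rw [rel_cast, rel_tensor]
  constructor
  · rintro (⟨a, -⟩ | ⟨a, b, h, h1, h2⟩)
    · exact a.elim0
    · obtain rfl : a = i := Fin.ext (by simpa using h1)
      obtain rfl : b = j := Fin.ext (by simpa using h2)
      exact h
  · exact fun h => Or.inr ⟨i, j, h, by simp, by simp⟩

theorem tensor_one (D : RookDiagram k l) :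
    (D.tensor (one 0)).cast (Nat.add_zero k) (Nat.add_zero l) = D := by
  refine rel_ext fun i j => ?_
  rw [rel_cast, rel_tensor]
  constructor
  · rintro (⟨a, b, h, h1, h2⟩ | ⟨a, -⟩)
    · obtain rfl : a = i := Fin.ext (by simpa using h1)
      obtain rfl : b = j := Fin.ext (by simpa using h2)
      exact h
    · exact a.elim0
  · exact fun h => Or.inl ⟨i, j, h, by simp, by simp⟩

end RookDiagram

/-- The rook diagram of a generator. -/
def RookGen.rook : ∀ {k l : ℕ}, RookGen k l → RookDiagram k l
  | _, _, .s => ⟨RookGen.s.diagram, by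
      rw [PartitionDiagram.isRook_iff]
      exact ⟨fun _ _ h => Fin.rev_injective h, fun _ _ h => h⟩⟩
  | _, _, .eta => ⟨RookGen.eta.diagram, by
      rw [PartitionDiagram.isRook_iff]
      exact ⟨fun i => i.elim0, fun _ _ _ => Subsingleton.elim _ _⟩⟩
  | _, _, .eps => ⟨RookGen.eps.diagram, by
      rw [PartitionDiagram.isRook_iff]
      exact ⟨fun _ _ _ => Subsingleton.elim _ _, fun i => i.elim0⟩⟩

theorem RookGen.rook_val {k l : ℕ} (g : RookGen k l) : g.rook.1 = g.diagram := by
  cases g <;> rfl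

/-! ### Rook diagrams drawn by words -/

namespace RookWord

/-- The rook diagram drawn by a word. -/
def rook : ∀ {k l : ℕ}, RookWord k l → RookDiagram k l
  | _, _, .gen g => g.rook
  | _, _, .id k => RookDiagram.one k
  | _, _, .comp v w => (rook v).star (rook w)
  | _, _, .tensor v w => (rook v).tensor (rook w)

/-- The recursion `rook` carries the rook property along, so this identity contains the claim that
every word draws a rook diagram. -/
theorem rook_val {k l : ℕ} (w : RookWord k l) : w.rook.1 = w.diagram := by
  induction w with
  | gen g => exact g.rook_val
  | id k => rfl
  | comp v w hv hw =>
    change PartitionDiagram.star v.rook.1 w.rook.1 = PartitionDiagram.star v.diagram w.diagram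
    rw [hv, hw]
  | tensor v w hv hw =>
    change PartitionDiagram.tensor v.rook.1 w.rook.1 =
      PartitionDiagram.tensor v.diagram w.diagram
    rw [hv, hw]

theorem loops_comp {k l m : ℕ} (v : RookWord l m) (w : RookWord k l) :
    (v.comp w).loops = v.loops + w.loops + v.rook.loops w.rook := by
  change v.loops + w.loops + PartitionDiagram.loops v.diagram w.diagram = _
  rw [← rook_val, ← rook_val]
  rfl

end RookWord


/-! ## Identities between small words -/

/-- The relation of being joined by a generator is decidable. -/
def RookGen.decRel : ∀ {k l : ℕ} (g : RookGen k l) (i : Fin k) (j : Fin l),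
    Decidable (g.rook.rel i j)
  | _, _, .s, i, j => inferInstanceAs (Decidable (i.rev = j))
  | _, _, .eta, i, _ => i.elim0
  | _, _, .eps, _, j => j.elim0

namespace RookWord

/-- The relation of being joined by a word is decidable. -/
def decRel : ∀ {k l : ℕ} (w : RookWord k l) (i : Fin k) (j : Fin l),
    Decidable (w.rook.rel i j)
  | _, _, .gen g, i, j => g.decRel i j
  | _, _, .id _, i, j => inferInstanceAs (Decidable (i = j))
  | _, _, .comp v w, i, j =>
    have := decRel v
    have := decRel w
    decidable_of_iff _ (RookDiagram.rel_star v.rook w.rook i j).symm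
  | _, _, .tensor v w, i, j =>
    have := decRel v
    have := decRel w
    decidable_of_iff _ (RookDiagram.rel_tensor v.rook w.rook i j).symm

instance {k l : ℕ} (w : RookWord k l) (i : Fin k) (j : Fin l) : Decidable (w.rook.rel i j) :=
  decRel w i j

/-- Two words draw the same rook diagram with the same number of closed components. -/
def SameDrawing {k l : ℕ} (w w' : RookWord k l) : Prop := w.rook = w'.rook ∧ w.loops = w'.loops

theorem SameDrawing.symm {k l : ℕ} {w w' : RookWord k l} (h : SameDrawing w w') :
    SameDrawing w' w := ⟨h.1.symm, h.2.symm⟩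

/-- The crossing, as a word. -/
abbrev sW : RookWord 2 2 := gen .s
/-- The generator `η`, as a word. -/
abbrev etaW : RookWord 0 1 := gen .eta
/-- The generator `ε`, as a word. -/
abbrev epsW : RookWord 1 0 := gen .eps
/-- The crossing of the first two of three strands, as a word. -/
abbrev sLeftW : RookWord 3 3 := sW.tensor (id 1)
/-- The crossing of the last two of three strands, as a word. -/
abbrev sRightW : RookWord 3 3 := (id 1).tensor sW

/-- The count of closed components is a cardinality of a quotient and does not compute. The
hypothesis replaces it by a finite condition on `rel` that `decide` can settle. -/
theorem loops_comp_eq_zero {k l m : ℕ} {v : RookWord l m} {w : RookWord k l}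
    (hv : v.loops = 0) (hw : w.loops = 0)
    (h : ∀ j, (∃ i, w.rook.rel i j) ∨ ∃ c, v.rook.rel j c) : (v.comp w).loops = 0 := by
  rw [loops_comp, hv, hw, RookDiagram.loops_eq_zero h]

theorem sameDrawing_of_loops_eq_zero {k l : ℕ} {w w' : RookWord k l}
    (h : ∀ i j, w.rook.rel i j ↔ w'.rook.rel i j) (hw : w.loops = 0) (hw' : w'.loops = 0) :
    SameDrawing w w' :=
  ⟨RookDiagram.rel_ext h, hw.trans hw'.symm⟩

theorem sameDrawing_s_s : SameDrawing (sW.comp sW) (id 2) :=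
  sameDrawing_of_loops_eq_zero (by decide) (loops_comp_eq_zero rfl rfl (by decide)) rfl

theorem sameDrawing_slide : SameDrawing (sW.comp (etaW.tensor (id 1))) ((id 1).tensor etaW) :=
  sameDrawing_of_loops_eq_zero (by decide) (loops_comp_eq_zero rfl rfl (by decide)) rfl

theorem sameDrawing_slide_flipV :
    SameDrawing (sW.comp ((id 1).tensor etaW)) (etaW.tensor (id 1)) :=
  sameDrawing_of_loops_eq_zero (by decide) (loops_comp_eq_zero rfl rfl (by decide)) rfl

theorem sameDrawing_slide_flipH :
    SameDrawing (RookWord.comp (epsW.tensor (id 1)) sW) ((id 1).tensor epsW) :=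
  sameDrawing_of_loops_eq_zero (by decide) (loops_comp_eq_zero rfl rfl (by decide)) rfl

theorem sameDrawing_slide_flipHV :
    SameDrawing (RookWord.comp ((id 1).tensor epsW) sW) (epsW.tensor (id 1)) :=
  sameDrawing_of_loops_eq_zero (by decide) (loops_comp_eq_zero rfl rfl (by decide)) rfl

set_option maxRecDepth 4000 in
theorem sameDrawing_braid : SameDrawing (sRightW.comp (sLeftW.comp sRightW))
    (sLeftW.comp (sRightW.comp sLeftW)) :=
  sameDrawing_of_loops_eq_zero (by decide)
    (loops_comp_eq_zero rfl (loops_comp_eq_zero rfl rfl (by decide)) (by decide))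
    (loops_comp_eq_zero rfl (loops_comp_eq_zero rfl rfl (by decide)) (by decide))

theorem sameDrawing_comp_assoc {k l m n : ℕ} (f : RookWord m n) (g : RookWord l m)
    (h : RookWord k l) : SameDrawing ((f.comp g).comp h) (f.comp (g.comp h)) := by
  refine ⟨RookDiagram.star_assoc _ _ _, ?_⟩
  have := RookDiagram.loops_assoc f.rook g.rook h.rook
  simp only [loops_comp, rook]
  omega

/-- The involution `*` reverses the three factors, which are palindromic, so only the bracketing of
the braid relation changes. -/
theorem sameDrawing_braid_flipH : SameDrawing ((sRightW.comp sLeftW).comp sRightW)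
    ((sLeftW.comp sRightW).comp sLeftW) := by
  have h1 := sameDrawing_comp_assoc sRightW sLeftW sRightW
  have h2 := sameDrawing_comp_assoc sLeftW sRightW sLeftW
  have h := sameDrawing_braid
  exact ⟨h1.1.trans (h.1.trans h2.1.symm), h1.2.trans (h.2.trans h2.2.symm)⟩

end RookWord

namespace RookDiagram

theorem loops_eps_eta : RookGen.eps.rook.loops RookGen.eta.rook = 1 := by
  rw [loops_eq_card]
  have : ∀ j : Fin 1, (∀ i, ¬ RookGen.eta.rook.rel i j) ∧ ∀ c, ¬ RookGen.eps.rook.rel j c :=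
    fun _ => ⟨fun i => i.elim0, fun c => c.elim0⟩
  rw [Nat.card_congr (Equiv.subtypeUnivEquiv this), Nat.card_fin]

end RookDiagram

/-! ## The linear category of rook diagrams -/

/-- Linear combinations of rook diagrams. -/
abbrev RookModule (𝕜 : Type u) [CommRing 𝕜] (k l : ℕ) : Type u := RookDiagram k l →₀ 𝕜

namespace RookModule

variable {𝕜 : Type u} [CommRing 𝕜] {k l m n k' l' m' k'' l'' : ℕ}

/-- Composition of linear combinations of rook diagrams, with parameter `t`. -/
def comp (t : 𝕜) : RookModule 𝕜 l m →ₗ[𝕜] RookModule 𝕜 k l →ₗ[𝕜] RookModule 𝕜 k m :=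
  Finsupp.linearCombination 𝕜 fun D : RookDiagram l m =>
    Finsupp.linearCombination 𝕜 fun D' : RookDiagram k l =>
      Finsupp.single (D.star D') (t ^ D.loops D')

/-- Juxtaposition of linear combinations of rook diagrams. -/
def tensor : RookModule 𝕜 k l →ₗ[𝕜] RookModule 𝕜 k' l' →ₗ[𝕜] RookModule 𝕜 (k + k') (l + l') :=
  Finsupp.linearCombination 𝕜 fun D : RookDiagram k l =>
    Finsupp.linearCombination 𝕜 fun D' : RookDiagram k' l' => Finsupp.single (D.tensor D') 1

theorem comp_single (t : 𝕜) (D : RookDiagram l m) (D' : RookDiagram k l) (a b : 𝕜) :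
    comp t (Finsupp.single D a) (Finsupp.single D' b) =
      Finsupp.single (D.star D') (a * b * t ^ D.loops D') := by
  simp only [comp, Finsupp.linearCombination_single, LinearMap.smul_apply, Finsupp.smul_single,
    smul_eq_mul, mul_assoc]

theorem tensor_single (D : RookDiagram k l) (D' : RookDiagram k' l') (a b : 𝕜) :
    tensor (Finsupp.single D a) (Finsupp.single D' b) =
      Finsupp.single (D.tensor D') (a * b) := by
  simp only [tensor, Finsupp.linearCombination_single, LinearMap.smul_apply,
    Finsupp.smul_single, smul_eq_mul, mul_one]

/-- By linearity it suffices to treat diagrams. The bracketing affects when closed components are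
removed, but not how many are removed in total. -/
theorem comp_assoc (t : 𝕜) (x : RookModule 𝕜 m n) (y : RookModule 𝕜 l m)
    (z : RookModule 𝕜 k l) : comp t (comp t x y) z = comp t x (comp t y z) := by
  induction x using Finsupp.induction_linear with
  | zero => simp
  | add x x' h h' => simp only [map_add, LinearMap.add_apply, h, h']
  | single D₁ a =>
    induction y using Finsupp.induction_linear with
    | zero => simp
    | add x x' h h' => simp only [map_add, LinearMap.add_apply, h, h']
    | single D₂ b =>
      induction z using Finsupp.induction_linear with
      | zero => simp
      | add x x' h h' => simp only [map_add, h, h']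
      | single D₃ c =>
        simp only [comp_single, RookDiagram.star_assoc]
        congr 1
        have h : t ^ D₁.loops D₂ * t ^ (D₁.star D₂).loops D₃ =
            t ^ D₂.loops D₃ * t ^ D₁.loops (D₂.star D₃) := by
          rw [← pow_add, ← pow_add, RookDiagram.loops_assoc]
        linear_combination (a * b * c) * h

theorem one_comp (t : 𝕜) (x : RookModule 𝕜 k l) :
    comp t (Finsupp.single (RookDiagram.one l) 1) x = x := by
  induction x using Finsupp.induction_linear with
  | zero => simp
  | add x x' h h' => simp only [map_add, h, h']
  | single D a => simp [comp_single, RookDiagram.one_star, RookDiagram.one_loops]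

theorem comp_one (t : 𝕜) (x : RookModule 𝕜 k l) :
    comp t x (Finsupp.single (RookDiagram.one k) 1) = x := by
  induction x using Finsupp.induction_linear with
  | zero => simp
  | add x x' h h' => simp only [map_add, LinearMap.add_apply, h, h']
  | single D a => simp [comp_single, RookDiagram.star_one, RookDiagram.loops_one]

theorem interchange (t : 𝕜) (x : RookModule 𝕜 l m) (y : RookModule 𝕜 k l)
    (x' : RookModule 𝕜 l' m') (y' : RookModule 𝕜 k' l') :
    comp t (tensor x x') (tensor y y') = tensor (comp t x y) (comp t x' y') := by
  induction x using Finsupp.induction_linear with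
  | zero => simp
  | add x x' h h' => simp only [map_add, LinearMap.add_apply, h, h']
  | single D₁ a =>
    induction y using Finsupp.induction_linear with
    | zero => simp
    | add x x' h h' => simp only [map_add, LinearMap.add_apply, h, h']
    | single D₂ b =>
      induction x' using Finsupp.induction_linear with
      | zero => simp
      | add x x' h h' => simp only [map_add, LinearMap.add_apply, h, h']
      | single D₁' c =>
        induction y' using Finsupp.induction_linear with
        | zero => simp
        | add x x' h h' => simp only [map_add, h, h']
        | single D₂' d =>
          simp only [comp_single, tensor_single, RookDiagram.star_tensor_star,
            RookDiagram.loops_tensor, pow_add]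
          congr 1
          ring

/-- Transport along equalities of the sizes of the rows. -/
def cast (hk : k = k') (hl : l = l') : RookModule 𝕜 k l →ₗ[𝕜] RookModule 𝕜 k' l' :=
  Finsupp.lmapDomain 𝕜 𝕜 (RookDiagram.cast hk hl)

theorem cast_single (hk : k = k') (hl : l = l') (D : RookDiagram k l) (a : 𝕜) :
    cast hk hl (Finsupp.single D a) = Finsupp.single (D.cast hk hl) a := by
  simp [cast]

theorem tensor_assoc (x : RookModule 𝕜 k l) (y : RookModule 𝕜 k' l')
    (z : RookModule 𝕜 k'' l'') :
    cast (Nat.add_assoc k k' k'') (Nat.add_assoc l l' l'') (tensor (tensor x y) z) =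
      tensor x (tensor y z) := by
  induction x using Finsupp.induction_linear with
  | zero => simp
  | add x x' h h' => simp only [map_add, LinearMap.add_apply, h, h']
  | single D₁ a =>
    induction y using Finsupp.induction_linear with
    | zero => simp
    | add x x' h h' => simp only [map_add, LinearMap.add_apply, h, h']
    | single D₂ b =>
      induction z using Finsupp.induction_linear with
      | zero => simp
      | add x x' h h' => simp only [map_add, h, h']
      | single D₃ c =>
        simp only [tensor_single, cast_single, RookDiagram.tensor_assoc, mul_assoc]

theorem one_tensor (x : RookModule 𝕜 k l) :
    cast (Nat.zero_add k) (Nat.zero_add l)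
      (tensor (Finsupp.single (RookDiagram.one 0) 1) x) = x := by
  induction x using Finsupp.induction_linear with
  | zero => simp
  | add x x' h h' => simp only [map_add, h, h']
  | single D a => simp only [tensor_single, cast_single, RookDiagram.one_tensor, one_mul]

theorem tensor_one (x : RookModule 𝕜 k l) :
    cast (Nat.add_zero k) (Nat.add_zero l)
      (tensor x (Finsupp.single (RookDiagram.one 0) 1)) = x := by
  induction x using Finsupp.induction_linear with
  | zero => simp
  | add x x' h h' => simp only [map_add, LinearMap.add_apply, h, h']
  | single D a => simp only [tensor_single, cast_single, RookDiagram.tensor_one, mul_one]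

end RookModule

/-! ### Evaluation of the rook category on rook diagrams -/

section Eval

variable {𝕜 : Type u} [CommRing 𝕜] (t : 𝕜)

/-- The linear combination of rook diagrams drawn by an expression. -/
def RookTerm.eval : ∀ {k l : ℕ}, RookTerm 𝕜 k l → RookModule 𝕜 k l
  | _, _, .gen g => Finsupp.single g.rook 1
  | _, _, .id k => Finsupp.single (RookDiagram.one k) 1
  | _, _, .comp f g => RookModule.comp t (eval f) (eval g)
  | _, _, .tensor f g => RookModule.tensor (eval f) (eval g)
  | _, _, .zero _ _ => 0
  | _, _, .add f g => eval f + eval g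
  | _, _, .smul a f => a • eval f

theorem RookTerm.eval_cast {k l k' l' : ℕ} (hk : k = k') (hl : l = l') (f : RookTerm 𝕜 k l) :
    RookTerm.eval t (f.cast hk hl) = RookModule.cast hk hl (RookTerm.eval t f) := by
  subst hk hl
  exact (Finsupp.mapDomain_id (v := RookTerm.eval t f)).symm

/-- The exponents add up under `∘` and `⊗` in the same way as the closed components of words. -/
theorem RookTerm.eval_toTerm {k l : ℕ} (w : RookWord k l) :
    RookTerm.eval t (w.toTerm 𝕜) = Finsupp.single w.rook (t ^ w.loops) := by
  induction w with
  | gen g => simp [RookWord.toTerm, RookTerm.eval, RookWord.rook, RookWord.loops]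
  | id k => simp [RookWord.toTerm, RookTerm.eval, RookWord.rook, RookWord.loops]
  | comp v w hv hw =>
    simp only [RookWord.toTerm, RookTerm.eval, RookWord.rook, hv, hw, RookModule.comp_single,
      RookWord.loops_comp, pow_add]
  | tensor v w hv hw =>
    simp only [RookWord.toTerm, RookTerm.eval, RookWord.rook, RookWord.loops, hv, hw,
      RookModule.tensor_single, pow_add]

variable {t}

theorem RookWord.SameDrawing.eval_eq {k l : ℕ} {w w' : RookWord k l} (h : w.SameDrawing w') :
    RookTerm.eval t (w.toTerm 𝕜) = RookTerm.eval t (w'.toTerm 𝕜) := by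
  rw [RookTerm.eval_toTerm, RookTerm.eval_toTerm, h.1, h.2]

theorem RookTerm.eval_loop :
    RookTerm.eval t (epsT.comp etaT) = RookTerm.eval t ((Term.id 0).smul t) := by
  change RookModule.comp t (Finsupp.single RookGen.eps.rook 1)
    (Finsupp.single RookGen.eta.rook 1) = t • Finsupp.single (RookDiagram.one 0) 1
  rw [RookModule.comp_single, RookDiagram.loops_eps_eta, Finsupp.smul_single]
  congr 1
  · exact RookDiagram.rel_ext fun i => i.elim0
  · simp

-- The transforms of each relation unfold to pairs of words. Both involutions fix `s ∘ s = 1` and `ε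
-- ∘ η = t`. Since `♯` swaps `s ⊗ 1` and `1 ⊗ s`, it turns the braid relation around, which accounts
-- for the uses of `symm`. Only the slide relation gives four different identities.
open RookWord in
theorem RookRel.eval_eq {k l : ℕ} {f g : RookTerm 𝕜 k l} (h : RookRel t f g) :
    RookTerm.eval t f = RookTerm.eval t g := by
  cases h with
  | base h =>
    cases h with
    | s_s => exact sameDrawing_s_s.eval_eq
    | braid => exact sameDrawing_braid.eval_eq
    | slide => exact sameDrawing_slide.eval_eq
    | loop => exact RookTerm.eval_loop
  | flipH h =>
    cases h with
    | s_s => exact sameDrawing_s_s.eval_eq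
    | braid => exact sameDrawing_braid_flipH.eval_eq
    | slide => exact sameDrawing_slide_flipH.eval_eq
    | loop => exact RookTerm.eval_loop
  | flipV h =>
    cases h with
    | s_s => exact sameDrawing_s_s.eval_eq
    | braid => exact sameDrawing_braid.symm.eval_eq
    | slide => exact sameDrawing_slide_flipV.eval_eq
    | loop => exact RookTerm.eval_loop
  | flipHV h =>
    cases h with
    | s_s => exact sameDrawing_s_s.eval_eq
    | braid => exact sameDrawing_braid_flipH.symm.eval_eq
    | slide => exact sameDrawing_slide_flipHV.eval_eq
    | loop => exact RookTerm.eval_loop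

/-- This is the functor out of the presented category: each axiom of a strict linear monoidal
category holds for combinations of rook diagrams, as do the defining relations. -/
theorem RookTerm.eval_eq_of_rel {k l : ℕ} {f g : RookTerm 𝕜 k l} (h : Rel (RookRel t) f g) :
    RookTerm.eval t f = RookTerm.eval t g := by
  induction h with
  | of h => exact h.eval_eq
  | refl f => rfl
  | symm _ h => exact h.symm
  | trans _ _ h h' => exact h.trans h'
  | comp_congr _ _ h h' => simp only [RookTerm.eval, h, h']
  | tensor_congr _ _ h h' => simp only [RookTerm.eval, h, h']
  | add_congr _ _ h h' => simp only [RookTerm.eval, h, h']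
  | smul_congr a _ h => simp only [RookTerm.eval, h]
  | id_comp f => exact RookModule.one_comp t _
  | comp_id f => exact RookModule.comp_one t _
  | comp_assoc f g h => exact RookModule.comp_assoc t _ _ _
  | add_comm f g => exact _root_.add_comm _ _
  | add_assoc f g h => exact _root_.add_assoc _ _ _
  | zero_add f => exact _root_.zero_add _
  | one_smul f => exact _root_.one_smul _ _
  | mul_smul a b f => exact (smul_smul _ _ _).symm
  | smul_add a f g => exact _root_.smul_add _ _ _
  | add_smul a b f => exact _root_.add_smul _ _ _
  | zero_smul f => exact _root_.zero_smul _ _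
  | comp_add f g h => simp only [RookTerm.eval, map_add]
  | add_comp f g h => simp only [RookTerm.eval, map_add, LinearMap.add_apply]
  | comp_smul a f g => simp only [RookTerm.eval, map_smul]
  | smul_comp a f g => simp only [RookTerm.eval, map_smul, LinearMap.smul_apply]
  | tensor_id k l =>
    simp only [RookTerm.eval, RookModule.tensor_single, RookDiagram.tensor_one_one, mul_one]
  | interchange f g f' g' => exact RookModule.interchange t _ _ _ _
  | tensor_add f g h => simp only [RookTerm.eval, map_add]
  | add_tensor f g h => simp only [RookTerm.eval, map_add, LinearMap.add_apply]
  | tensor_smul a f g => simp only [RookTerm.eval, map_smul]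
  | smul_tensor a f g => simp only [RookTerm.eval, map_smul, LinearMap.smul_apply]
  | tensor_assoc f g h =>
    rw [RookTerm.eval_cast]
    exact RookModule.tensor_assoc _ _ _
  | one_tensor f =>
    rw [RookTerm.eval_cast]
    exact RookModule.one_tensor _
  | tensor_one f =>
    rw [RookTerm.eval_cast]
    exact RookModule.tensor_one _

variable (t) in
/-- The linear combination of rook diagrams drawn by a morphism of the rook category. -/
def PHom.eval (k l : ℕ) : PHom (RookRel t) k l →ₗ[𝕜] RookModule 𝕜 k l where
  toFun := Quotient.lift (RookTerm.eval t) fun _ _ h => RookTerm.eval_eq_of_rel h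
  map_add' f g := by
    obtain ⟨f, rfl⟩ := PHom.exists_rep f
    obtain ⟨g, rfl⟩ := PHom.exists_rep g
    rfl
  map_smul' a f := by
    obtain ⟨f, rfl⟩ := PHom.exists_rep f
    rfl

theorem PHom.eval_word {k l : ℕ} (w : RookWord k l) :
    PHom.eval t k l (PHom.mk (w.toTerm 𝕜)) = Finsupp.single w.rook (t ^ w.loops) :=
  RookTerm.eval_toTerm t w

end Eval


/-! ## Morphisms together with their drawings -/

/-- A morphism of the rook category, together with a rook diagram and a number of closed
components. -/
@[ext]
structure Tracked {𝕜 : Type u} [CommRing 𝕜] (t : 𝕜) (k l : ℕ) where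
  /-- The morphism. -/
  hom : PHom (RookRel t) k l
  /-- The rook diagram. -/
  diag : RookDiagram k l
  /-- The number of closed components. -/
  cnt : ℕ

theorem PHom.mk_cast {𝕜 : Type u} [CommRing 𝕜] {G : ℕ → ℕ → Type}
    {R : ∀ ⦃k l : ℕ⦄, Term 𝕜 G k l → Term 𝕜 G k l → Prop} {k l k' l' : ℕ} (hk : k = k')
    (hl : l = l') (f : Term 𝕜 G k l) :
    (PHom.mk (f.cast hk hl) : PHom R k' l') = hl ▸ hk ▸ (PHom.mk f : PHom R k l) := by
  subst hk hl
  rfl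

namespace Tracked

variable {𝕜 : Type u} [CommRing 𝕜] {t : 𝕜} {k l m n k' l' m' k'' l'' : ℕ}

/-- The identity. -/
def id (t : 𝕜) (k : ℕ) : Tracked t k k := ⟨PHom.mk (Term.id k), RookDiagram.one k, 0⟩

/-- Composition. -/
def comp (f : Tracked t l m) (g : Tracked t k l) : Tracked t k m :=
  ⟨f.hom.comp g.hom, f.diag.star g.diag, f.cnt + g.cnt + f.diag.loops g.diag⟩

/-- Tensor product. -/
def tensor (f : Tracked t k l) (g : Tracked t k' l') : Tracked t (k + k') (l + l') :=
  ⟨f.hom.tensor g.hom, f.diag.tensor g.diag, f.cnt + g.cnt⟩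

/-- Adding closed components. -/
def addLoops (n : ℕ) (f : Tracked t k l) : Tracked t k l := ⟨t ^ n • f.hom, f.diag, n + f.cnt⟩

/-- Transport along equalities of objects. -/
def cast (hk : k = k') (hl : l = l') (f : Tracked t k l) : Tracked t k' l' := hl ▸ hk ▸ f

/-- A word, together with its drawing. -/
def ofWord (t : 𝕜) (w : RookWord k l) : Tracked t k l :=
  ⟨PHom.mk (w.toTerm 𝕜), w.rook, w.loops⟩

theorem id_comp (f : Tracked t k l) : (id t l).comp f = f := by
  obtain ⟨f, D, c⟩ := f
  obtain ⟨f, rfl⟩ := PHom.exists_rep f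
  refine Tracked.ext (PHom.sound (Rel.id_comp f)) (RookDiagram.one_star _) ?_
  simp [comp, id, RookDiagram.one_loops]

theorem comp_id (f : Tracked t k l) : f.comp (id t k) = f := by
  obtain ⟨f, D, c⟩ := f
  obtain ⟨f, rfl⟩ := PHom.exists_rep f
  refine Tracked.ext (PHom.sound (Rel.comp_id f)) (RookDiagram.star_one _) ?_
  simp [comp, id, RookDiagram.loops_one]

theorem comp_assoc (f : Tracked t m n) (g : Tracked t l m) (h : Tracked t k l) :
    (f.comp g).comp h = f.comp (g.comp h) := by
  obtain ⟨f, D₁, c₁⟩ := f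
  obtain ⟨g, D₂, c₂⟩ := g
  obtain ⟨h, D₃, c₃⟩ := h
  obtain ⟨f, rfl⟩ := PHom.exists_rep f
  obtain ⟨g, rfl⟩ := PHom.exists_rep g
  obtain ⟨h, rfl⟩ := PHom.exists_rep h
  refine Tracked.ext (PHom.sound (Rel.comp_assoc f g h)) (RookDiagram.star_assoc _ _ _) ?_
  have := RookDiagram.loops_assoc D₁ D₂ D₃
  simp only [comp]
  omega

theorem tensor_id (k l : ℕ) : (id t k).tensor (id t l) = id t (k + l) :=
  Tracked.ext (PHom.sound (Rel.tensor_id k l)) (RookDiagram.tensor_one_one k l) rfl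

theorem interchange (f : Tracked t l m) (g : Tracked t k l) (f' : Tracked t l' m')
    (g' : Tracked t k' l') :
    (f.tensor f').comp (g.tensor g') = (f.comp g).tensor (f'.comp g') := by
  obtain ⟨f, D₁, c₁⟩ := f
  obtain ⟨g, D₂, c₂⟩ := g
  obtain ⟨f', D₁', c₁'⟩ := f'
  obtain ⟨g', D₂', c₂'⟩ := g'
  obtain ⟨f, rfl⟩ := PHom.exists_rep f
  obtain ⟨g, rfl⟩ := PHom.exists_rep g
  obtain ⟨f', rfl⟩ := PHom.exists_rep f'
  obtain ⟨g', rfl⟩ := PHom.exists_rep g'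
  refine Tracked.ext (PHom.sound (Rel.interchange f g f' g'))
    (RookDiagram.star_tensor_star _ _ _ _) ?_
  simp only [comp, tensor, RookDiagram.loops_tensor]
  omega

theorem cast_hom (hk : k = k') (hl : l = l') (f : Tracked t k l) :
    (f.cast hk hl).hom = hl ▸ hk ▸ f.hom := by
  subst hk hl
  rfl

theorem cast_diag (hk : k = k') (hl : l = l') (f : Tracked t k l) :
    (f.cast hk hl).diag = f.diag.cast hk hl := by
  subst hk hl
  rfl

theorem cast_cnt (hk : k = k') (hl : l = l') (f : Tracked t k l) :
    (f.cast hk hl).cnt = f.cnt := by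
  subst hk hl
  rfl

theorem tensor_assoc (f : Tracked t k l) (g : Tracked t k' l') (h : Tracked t k'' l'') :
    ((f.tensor g).tensor h).cast (Nat.add_assoc k k' k'') (Nat.add_assoc l l' l'') =
      f.tensor (g.tensor h) := by
  obtain ⟨f, D₁, c₁⟩ := f
  obtain ⟨g, D₂, c₂⟩ := g
  obtain ⟨h, D₃, c₃⟩ := h
  obtain ⟨f, rfl⟩ := PHom.exists_rep f
  obtain ⟨g, rfl⟩ := PHom.exists_rep g
  obtain ⟨h, rfl⟩ := PHom.exists_rep h
  refine Tracked.ext ?_ ?_ ?_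
  · rw [cast_hom]
    exact (PHom.mk_cast _ _ _).symm.trans (PHom.sound (Rel.tensor_assoc f g h))
  · rw [cast_diag]
    exact RookDiagram.tensor_assoc _ _ _
  · rw [cast_cnt]
    exact Nat.add_assoc _ _ _

theorem one_tensor (f : Tracked t k l) :
    ((id t 0).tensor f).cast (Nat.zero_add k) (Nat.zero_add l) = f := by
  obtain ⟨f, D, c⟩ := f
  obtain ⟨f, rfl⟩ := PHom.exists_rep f
  refine Tracked.ext ?_ ?_ ?_
  · rw [cast_hom]
    exact (PHom.mk_cast _ _ _).symm.trans (PHom.sound (Rel.one_tensor f))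
  · rw [cast_diag]
    exact RookDiagram.one_tensor _
  · rw [cast_cnt]
    exact Nat.zero_add _

/-- Since `k + 0` computes to `k`, the right unit law needs no transport, unlike the left one.
Strands are added on the right below for the same reason. -/
theorem tensor_id_zero (f : Tracked t k l) : f.tensor (id t 0) = f := by
  obtain ⟨f, D, c⟩ := f
  obtain ⟨f, rfl⟩ := PHom.exists_rep f
  exact Tracked.ext (PHom.sound (Rel.tensor_one f)) (RookDiagram.tensor_one D) rfl

/-- Together with `tensor_eq'` this says that morphisms acting on disjoint strands commute, which is
the source of all the sliding rules below. -/
theorem tensor_eq (f : Tracked t k l) (g : Tracked t k' l') :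
    f.tensor g = (f.tensor (id t l')).comp ((id t k).tensor g) := by
  rw [interchange, comp_id, id_comp]

theorem tensor_eq' (f : Tracked t k l) (g : Tracked t k' l') :
    f.tensor g = ((id t l).tensor g).comp (f.tensor (id t k')) := by
  rw [interchange, comp_id, id_comp]

theorem addLoops_zero (f : Tracked t k l) : addLoops 0 f = f :=
  Tracked.ext (by simp [addLoops]) rfl (Nat.zero_add _)

theorem addLoops_addLoops (n n' : ℕ) (f : Tracked t k l) :
    addLoops n (addLoops n' f) = addLoops (n + n') f :=
  Tracked.ext (by simp [addLoops, pow_add, smul_smul]) rfl (Nat.add_assoc _ _ _).symm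

theorem comp_addLoops (n : ℕ) (f : Tracked t l m) (g : Tracked t k l) :
    f.comp (addLoops n g) = addLoops n (f.comp g) := by
  obtain ⟨f, D₁, c₁⟩ := f
  obtain ⟨g, D₂, c₂⟩ := g
  obtain ⟨f, rfl⟩ := PHom.exists_rep f
  obtain ⟨g, rfl⟩ := PHom.exists_rep g
  refine Tracked.ext (PHom.sound (Rel.comp_smul _ f g)) rfl ?_
  simp only [comp, addLoops]
  omega

theorem addLoops_comp (n : ℕ) (f : Tracked t l m) (g : Tracked t k l) :
    (addLoops n f).comp g = addLoops n (f.comp g) := by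
  obtain ⟨f, D₁, c₁⟩ := f
  obtain ⟨g, D₂, c₂⟩ := g
  obtain ⟨f, rfl⟩ := PHom.exists_rep f
  obtain ⟨g, rfl⟩ := PHom.exists_rep g
  refine Tracked.ext (PHom.sound (Rel.smul_comp _ f g)) rfl ?_
  simp only [comp, addLoops]
  omega

theorem tensor_addLoops (n : ℕ) (f : Tracked t k l) (g : Tracked t k' l') :
    f.tensor (addLoops n g) = addLoops n (f.tensor g) := by
  obtain ⟨f, D₁, c₁⟩ := f
  obtain ⟨g, D₂, c₂⟩ := g
  obtain ⟨f, rfl⟩ := PHom.exists_rep f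
  obtain ⟨g, rfl⟩ := PHom.exists_rep g
  refine Tracked.ext (PHom.sound (Rel.tensor_smul _ f g)) rfl ?_
  simp only [tensor, addLoops]
  omega

theorem addLoops_tensor (n : ℕ) (f : Tracked t k l) (g : Tracked t k' l') :
    (addLoops n f).tensor g = addLoops n (f.tensor g) := by
  obtain ⟨f, D₁, c₁⟩ := f
  obtain ⟨g, D₂, c₂⟩ := g
  obtain ⟨f, rfl⟩ := PHom.exists_rep f
  obtain ⟨g, rfl⟩ := PHom.exists_rep g
  refine Tracked.ext (PHom.sound (Rel.smul_tensor _ f g)) rfl ?_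
  simp only [tensor, addLoops]
  omega

theorem ofWord_comp (v : RookWord l m) (w : RookWord k l) :
    ofWord t (v.comp w) = (ofWord t v).comp (ofWord t w) :=
  Tracked.ext rfl rfl (RookWord.loops_comp v w)

theorem ofWord_tensor (v : RookWord k l) (w : RookWord k' l') :
    ofWord t (v.tensor w) = (ofWord t v).tensor (ofWord t w) := rfl

theorem ofWord_eq {w w' : RookWord k l} (h : Rel (RookRel t) (w.toTerm 𝕜) (w'.toTerm 𝕜))
    (hd : w.SameDrawing w') : ofWord t w = ofWord t w' :=
  Tracked.ext (PHom.sound h) hd.1 hd.2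

/-! ### The generators and their relations -/

/-- A generator. -/
def gen (t : 𝕜) (g : RookGen k l) : Tracked t k l := ofWord t (RookWord.gen g)

/-- The crossing of the last two strands. -/
def crossing (t : 𝕜) (l : ℕ) : Tracked t (l + 2) (l + 2) := (id t l).tensor (gen t .s)

/-- An end point of the top row added as the last point. -/
def birth (t : 𝕜) (l : ℕ) : Tracked t l (l + 1) := (id t l).tensor (gen t .eta)

/-- An end point of the bottom row added as the last point. -/
def death (t : 𝕜) (l : ℕ) : Tracked t (l + 1) l := (id t l).tensor (gen t .eps)

/-- A strand added on the right. -/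
def strand (f : Tracked t k l) : Tracked t (k + 1) (l + 1) := f.tensor (id t 1)

theorem strand_id (k : ℕ) : (id t k).strand = id t (k + 1) := tensor_id k 1

theorem strand_comp (f : Tracked t l m) (g : Tracked t k l) :
    (f.comp g).strand = f.strand.comp g.strand := by
  rw [strand, strand, strand, interchange, comp_id]

theorem strand_addLoops (n : ℕ) (f : Tracked t k l) :
    (addLoops n f).strand = addLoops n f.strand := addLoops_tensor n f _

theorem strand_strand (f : Tracked t k l) : f.strand.strand = f.tensor (id t 2) := by
  rw [← tensor_id 1 1]
  exact tensor_assoc f (id t 1) (id t 1)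

theorem id_tensor_strand (a : ℕ) (f : Tracked t k l) :
    (id t a).tensor f.strand = ((id t a).tensor f).strand :=
  (tensor_assoc (id t a) f (id t 1)).symm

/-- A generator acting on the last strands stays of this kind when strands are added on the left.
Relations on at most three strands thereby extend to any number of strands. -/
theorem id_tensor_id_tensor (a b : ℕ) (f : Tracked t k l) :
    (id t a).tensor ((id t b).tensor f) =
      ((id t (a + b)).tensor f).cast (Nat.add_assoc a b k) (Nat.add_assoc a b l) := by
  rw [← tensor_assoc, tensor_id]

theorem crossing_comp_strand_strand (f : Tracked t k l) :
    (crossing t l).comp f.strand.strand = f.strand.strand.comp (crossing t k) := by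
  rw [strand_strand, crossing, crossing, ← tensor_eq, ← tensor_eq']

/-- The new end point lies to the right of everything that `f` touches, so the two can be exchanged.
-/
theorem birth_comp (f : Tracked t k l) :
    (birth t l).comp f = f.strand.comp (birth t k) := by
  have h := tensor_eq' f (gen t .eta)
  rw [tensor_id_zero] at h
  exact h.symm.trans (tensor_eq f (gen t .eta))

theorem comp_death (f : Tracked t k l) :
    f.comp (death t k) = (death t l).comp f.strand := by
  have h := tensor_eq f (gen t .eps)
  rw [tensor_id_zero] at h
  exact h.symm.trans (tensor_eq' f (gen t .eps))

open RookWord in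
theorem gen_s_comp_gen_s : (gen t .s).comp (gen t .s) = id t 2 :=
  (ofWord_comp _ _).symm.trans
    (ofWord_eq (w := sW.comp sW) (.of (.base .s_s)) sameDrawing_s_s)

theorem crossing_comp_crossing (l : ℕ) : (crossing t l).comp (crossing t l) = id t (l + 2) := by
  rw [crossing, interchange, gen_s_comp_gen_s, comp_id, tensor_id]

open RookWord in
theorem braid_three :
    (crossing t 1).comp ((gen t .s).strand.comp (crossing t 1)) =
      (gen t .s).strand.comp ((crossing t 1).comp (gen t .s).strand) := by
  have h := ofWord_eq (t := t) (.of (.base .braid)) sameDrawing_braid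
  simp only [ofWord_comp] at h
  exact h

theorem id_tensor_comp (a : ℕ) (f : Tracked t l m) (g : Tracked t k l) :
    (id t a).tensor (f.comp g) = ((id t a).tensor f).comp ((id t a).tensor g) := by
  rw [interchange, comp_id]

theorem crossing_braid (l : ℕ) :
    (crossing t (l + 1)).comp ((crossing t l).strand.comp (crossing t (l + 1))) =
      (crossing t l).strand.comp ((crossing t (l + 1)).comp (crossing t l).strand) := by
  have h := congrArg (id t l).tensor (braid_three (t := t))
  have h1 : (id t l).tensor (crossing t 1) = crossing t (l + 1) :=
    id_tensor_id_tensor l 1 (gen t .s)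
  have h2 : (id t l).tensor (gen t .s).strand = (crossing t l).strand :=
    id_tensor_strand l (gen t .s)
  simp only [id_tensor_comp] at h
  rw [h1, h2] at h
  exact h

-- The `♯`-transform of the slide relation, with strands added on the left: an end point born in
-- last position is moved one place to the left. The opposite move follows from `s ∘ s = 1`.
open RookWord in
theorem crossing_comp_birth (l : ℕ) :
    (crossing t l).comp (birth t (l + 1)) = (birth t l).strand := by
  have h := ofWord_eq (t := t) (.of (.flipV .slide)) sameDrawing_slide_flipV
  rw [ofWord_comp] at h
  have h := congrArg (id t l).tensor h
  rw [id_tensor_comp] at h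
  have h1 : (id t l).tensor ((id t 1).tensor (gen t .eta)) = birth t (l + 1) :=
    id_tensor_id_tensor l 1 (gen t .eta)
  have h2 : (id t l).tensor (gen t .eta).strand = (birth t l).strand :=
    id_tensor_strand l (gen t .eta)
  rw [← h1, ← h2]
  exact h

theorem crossing_comp_birth_strand (l : ℕ) :
    (crossing t l).comp (birth t l).strand = birth t (l + 1) := by
  rw [← crossing_comp_birth, ← comp_assoc, crossing_comp_crossing, id_comp]

-- The slide relation transformed by both `*` and `♯`: a death of the last strand after a crossing
-- is a death of the strand before it.
open RookWord in
theorem death_comp_crossing (l : ℕ) :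
    (death t (l + 1)).comp (crossing t l) = (death t l).strand := by
  have h := ofWord_eq (t := t) (.of (.flipHV .slide)) sameDrawing_slide_flipHV
  rw [ofWord_comp] at h
  have h := congrArg (id t l).tensor h
  rw [id_tensor_comp] at h
  have h1 : (id t l).tensor ((id t 1).tensor (gen t .eps)) = death t (l + 1) :=
    id_tensor_id_tensor l 1 (gen t .eps)
  have h2 : (id t l).tensor (gen t .eps).strand = (death t l).strand :=
    id_tensor_strand l (gen t .eps)
  rw [← h1, ← h2]
  exact h

theorem death_strand_comp_crossing (l : ℕ) :
    (death t l).strand.comp (crossing t l) = death t (l + 1) := by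
  rw [← death_comp_crossing, comp_assoc, crossing_comp_crossing, comp_id]

/-- The one relation that produces a closed component. The factor `t` and the increase of the count
are recorded together by `addLoops 1`. -/
theorem death_comp_birth (l : ℕ) : (death t l).comp (birth t l) = addLoops 1 (id t l) := by
  have h : (gen t .eps).comp (gen t .eta) = addLoops 1 (id t 0) := by
    refine Tracked.ext ?_ (RookDiagram.rel_ext fun i => i.elim0) ?_
    · change PHom.mk (epsT.comp etaT) = t ^ 1 • PHom.mk (Term.id 0)
      rw [pow_one]
      exact PHom.sound (.of (.base .loop))
    · exact congrArg (0 + 0 + ·) RookDiagram.loops_eps_eta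
  rw [death, birth, interchange, h, comp_id, tensor_addLoops, tensor_id_zero]

end Tracked


/-- The restriction of a rook diagram to some of its vertices. -/
def RookDiagram.restrict {k l k' l' : ℕ} (D : RookDiagram k l) {f : Fin k' → Fin k}
    (hf : Function.Injective f) {g : Fin l' → Fin l} (hg : Function.Injective g) :
    RookDiagram k' l' :=
  ⟨D.1.comap (Sum.map f g), by
    rw [PartitionDiagram.isRook_iff]
    exact ⟨fun _ _ h => hf (D.2.eq_left h), fun _ _ h => hg (D.2.eq_right h)⟩⟩

/-! ## Normal forms -/

namespace Tracked

variable {𝕜 : Type u} [CommRing 𝕜] {t : 𝕜} {k l m n k' l' m' : ℕ}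

variable (t) in
/-- The morphisms obtained from crossings, births and deaths of the last strands by composition
and by adding strands on the right. -/
inductive Generated : ∀ {k l : ℕ}, Tracked t k l → Prop
  | id (k : ℕ) : Generated (id t k)
  | comp {k l m : ℕ} {f : Tracked t l m} {g : Tracked t k l} :
      Generated f → Generated g → Generated (f.comp g)
  | crossing (l : ℕ) : Generated (crossing t l)
  | birth (l : ℕ) : Generated (birth t l)
  | death (l : ℕ) : Generated (death t l)
  | strand {k l : ℕ} {f : Tracked t k l} : Generated f → Generated f.strand

variable (t) in
/-- The morphisms moving the last strand to the left. -/
inductive IsCycle : ∀ (l m : ℕ), Tracked t (l + 1) m → Prop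
  | id (l : ℕ) : IsCycle l (l + 1) (Tracked.id t (l + 1))
  | step {l m : ℕ} {f : Tracked t (l + 1) m} : IsCycle l m f →
      IsCycle (l + 1) (m + 1) (f.strand.comp (Tracked.crossing t l))

variable (t) in
/-- The morphisms in normal form. -/
inductive IsNormal : ∀ (k m : ℕ), Tracked t k m → Prop
  | nil : IsNormal 0 0 (Tracked.id t 0)
  | birth {m : ℕ} {f : Tracked t 0 m} : IsNormal 0 m f →
      IsNormal 0 (m + 1) ((Tracked.birth t m).comp f)
  | death {k m : ℕ} {f : Tracked t k m} : IsNormal k m f →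
      IsNormal (k + 1) m (f.comp (Tracked.death t k))
  | cycle {k l m : ℕ} {c : Tracked t (l + 1) m} {f : Tracked t k l} : IsCycle t l m c →
      IsNormal k l f → IsNormal (k + 1) m (c.comp f.strand)

/-- Follow through `e` the strand that `c` carries away from the last position. If it reaches the
top, it can be pulled out as a new cycle `c'`, while a morphism `e'` acts on the remaining strands.
If it ends inside `e`, it can be retracted to a death at the very bottom. The induction on `e` turns
this picture into rewriting by the relations. -/
theorem Generated.comp_cycle {e : Tracked t m m'} (he : Generated t e) :
    ∀ {l : ℕ} {c : Tracked t (l + 1) m}, IsCycle t l m c →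
      (∃ (l' : ℕ) (c' : Tracked t (l' + 1) m') (e' : Tracked t l l'), IsCycle t l' m' c' ∧
        Generated t e' ∧ e.comp c = c'.comp e'.strand) ∨
      ∃ e' : Tracked t l m', Generated t e' ∧ e.comp c = e'.comp (Tracked.death t l) := by
  induction he with
  | id m =>
    intro l c hc
    exact Or.inl ⟨l, c, _, hc, .id l, by rw [strand_id, comp_id, id_comp]⟩
  | comp _ hg ihf ihg =>
    intro l c hc
    rcases ihg hc with ⟨l', c', e', hc', he', h⟩ | ⟨e', he', h⟩
    · rcases ihf hc' with ⟨l'', c'', e'', hc'', he'', h'⟩ | ⟨e'', he'', h'⟩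
      · refine Or.inl ⟨l'', c'', _, hc'', he''.comp he', ?_⟩
        rw [comp_assoc, h, ← comp_assoc, h', strand_comp, comp_assoc]
      · refine Or.inr ⟨_, he''.comp he', ?_⟩
        rw [comp_assoc, h, ← comp_assoc, h', comp_assoc, ← comp_death, comp_assoc]
    · refine Or.inr ⟨_, Generated.comp ‹_› he', ?_⟩
      rw [comp_assoc, h, comp_assoc]
  -- There are three cases. If the carried strand is last at the top, the crossing prolongs the
  -- cycle by one step. If it is last but one, the crossing undoes one step. If it is further left,
  -- the crossing involves two other strands and passes below the cycle by the braid relation.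
  | crossing a =>
    intro l c hc
    cases hc with
    | id =>
      refine Or.inl ⟨_, _, _, .step (.id a), .id _, ?_⟩
      rw [strand_id, comp_id, comp_id]
      exact (id_comp _).symm
    | step hc =>
      cases hc with
      | id =>
        refine Or.inl ⟨_, _, _, .id _, .id _, ?_⟩
        rw [strand_id, comp_id]
        exact (congrArg _ (id_comp _)).trans (crossing_comp_crossing _)
      | @step l a f hc =>
        refine Or.inl ⟨_, _, _, hc.step.step, .crossing l, ?_⟩
        have h1 := crossing_comp_strand_strand f
        have h2 := crossing_braid (t := t) l
        calc _ = ((Tracked.crossing t a).comp f.strand.strand).comp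
              ((Tracked.crossing t l).strand.comp (Tracked.crossing t (l + 1))) := by
              rw [strand_comp, comp_assoc, comp_assoc]
          _ = f.strand.strand.comp ((Tracked.crossing t (l + 1)).comp
              ((Tracked.crossing t l).strand.comp (Tracked.crossing t (l + 1)))) := by
              rw [h1, comp_assoc]
          _ = _ := by
              rw [h2, strand_comp, comp_assoc, comp_assoc]
  -- A new top point appears to the right of the carried strand, so the cycle needs one more step.
  | birth a =>
    intro l c hc
    cases hc with
    | id =>
      refine Or.inl ⟨_, _, _, .step (.id _), .birth l, ?_⟩
      rw [comp_id, strand_id, id_comp, crossing_comp_birth_strand]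
    | step hc =>
      refine Or.inl ⟨_, _, _, hc.step.step, .birth _, ?_⟩
      rw [birth_comp, comp_assoc, crossing_comp_birth_strand]
  -- The death ends the carried strand exactly when that strand is last. Otherwise it ends another
  -- strand, and the cycle loses a step.
  | death a =>
    intro l c hc
    cases hc with
    | id =>
      exact Or.inr ⟨_, .id _, by rw [comp_id, id_comp]⟩
    | step hc =>
      refine Or.inl ⟨_, _, _, hc, .death _, ?_⟩
      rw [← comp_assoc, ← comp_death, comp_assoc, death_comp_crossing]
  -- If the carried strand is the added one, `e` does not touch it. Otherwise the cycle has a first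
  -- crossing, and the induction hypothesis applies to what follows it.
  | strand he ih =>
    intro l c hc
    cases hc with
    | id =>
      refine Or.inl ⟨_, _, _, .id _, he, ?_⟩
      rw [comp_id, id_comp]
    | step hc =>
      rcases ih hc with ⟨l', c', e', hc', he', h⟩ | ⟨e', he', h⟩
      · refine Or.inl ⟨_, _, _, hc'.step, he'.strand, ?_⟩
        rw [← comp_assoc, ← strand_comp, h, strand_comp, comp_assoc, comp_assoc,
          crossing_comp_strand_strand]
      · refine Or.inr ⟨_, he'.strand, ?_⟩
        rw [← comp_assoc, ← strand_comp, h, strand_comp, comp_assoc,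
          death_strand_comp_crossing]

/-- With an empty bottom row a normal form is a pile of births: crossings are absorbed by it, births
enlarge it, and a death cancels a birth at the cost of a closed component. -/
theorem Generated.comp_normal_zero {e : Tracked t m m'} (he : Generated t e) :
    ∀ {f : Tracked t 0 m}, IsNormal t 0 m f →
      ∃ n f', IsNormal t 0 m' f' ∧ e.comp f = addLoops n f' := by
  induction he with
  | id m => exact fun hf => ⟨0, _, hf, by rw [id_comp, addLoops_zero]⟩
  | comp _ _ ihf ihg =>
    intro f hf
    obtain ⟨n, f', hf', h⟩ := ihg hf
    obtain ⟨n', f'', hf'', h'⟩ := ihf hf'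
    exact ⟨_, _, hf'', by rw [comp_assoc, h, comp_addLoops, h', addLoops_addLoops]⟩
  | crossing l =>
    intro f hf
    cases hf with
    | birth hf =>
      cases hf with
      | birth hf =>
        refine ⟨0, _, hf.birth.birth, ?_⟩
        rw [addLoops_zero, ← comp_assoc, crossing_comp_birth, ← comp_assoc, ← birth_comp,
          comp_assoc]
  | birth l => exact fun hf => ⟨0, _, hf.birth, (addLoops_zero _).symm⟩
  | death l =>
    intro f hf
    cases hf with
    | birth hf =>
      exact ⟨1, _, hf, by rw [← comp_assoc, death_comp_birth, addLoops_comp, id_comp]⟩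
  | strand he ih =>
    intro f hf
    cases hf with
    | birth hf =>
      obtain ⟨n, f', hf', h⟩ := ih hf
      exact ⟨n, _, hf'.birth, by rw [← comp_assoc, ← birth_comp, comp_assoc, h, comp_addLoops]⟩

/-- Induction on the bottom row. A leading cycle lets `e` through by `comp_cycle`, leaving a
morphism `e'` that meets the shorter normal form; when the carried strand ends in `e`, the step
becomes a death. -/
theorem IsNormal.generated_comp {f : Tracked t k m} (hf : IsNormal t k m f) :
    ∀ {m' : ℕ} {e : Tracked t m m'}, Generated t e →
      ∃ n f', IsNormal t k m' f' ∧ e.comp f = addLoops n f' := by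
  induction hf with
  | nil => exact fun he => he.comp_normal_zero .nil
  | birth hf => exact fun he => he.comp_normal_zero hf.birth
  | death _ ih =>
    intro m' e he
    obtain ⟨n, f', hf', h⟩ := ih he
    exact ⟨n, _, hf'.death, by rw [← comp_assoc, h, addLoops_comp]⟩
  | cycle hc _ ih =>
    intro m' e he
    rcases he.comp_cycle hc with ⟨l', c', e', hc', he', h⟩ | ⟨e', he', h⟩
    · obtain ⟨n, f', hf', h'⟩ := ih he'
      refine ⟨n, _, .cycle hc' hf', ?_⟩
      rw [← comp_assoc, h, comp_assoc, ← strand_comp, h', strand_addLoops, comp_addLoops]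
    · obtain ⟨n, f', hf', h'⟩ := ih he'
      refine ⟨n, _, hf'.death, ?_⟩
      rw [← comp_assoc, h, comp_assoc, ← comp_death, ← comp_assoc, h', addLoops_comp]

theorem isNormal_id : ∀ k : ℕ, IsNormal t k k (id t k)
  | 0 => .nil
  | k + 1 => by
    have h := IsNormal.cycle (.id k) (isNormal_id k)
    rwa [strand_id, comp_id] at h

/-! ### Every word is generated -/

theorem Generated.tensor_id {f : Tracked t k l} (hf : Generated t f) :
    ∀ n : ℕ, Generated t (f.tensor (Tracked.id t n))
  | 0 => by rwa [tensor_id_zero]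
  | n + 1 => by
    have h : f.tensor (Tracked.id t (n + 1)) = (f.tensor (Tracked.id t n)).strand := by
      rw [← Tracked.tensor_id n 1]
      exact (tensor_assoc f (Tracked.id t n) (Tracked.id t 1)).symm
    rw [h]
    exact (hf.tensor_id n).strand

/-- Strands on the left are absorbed into the identity part of each generating morphism, so closure
on this side need not be imposed in `Generated`. -/
theorem Generated.id_tensor (a : ℕ) {f : Tracked t k l} (hf : Generated t f) :
    Generated t ((Tracked.id t a).tensor f) := by
  induction hf with
  | id k =>
    rw [Tracked.tensor_id]
    exact .id _
  | comp _ _ hf hg =>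
    rw [id_tensor_comp]
    exact hf.comp hg
  | crossing l =>
    have h := id_tensor_id_tensor a l (gen t .s)
    exact h.symm ▸ Generated.crossing (t := t) (a + l)
  | birth l =>
    have h := id_tensor_id_tensor a l (gen t .eta)
    exact h.symm ▸ Generated.birth (t := t) (a + l)
  | death l =>
    have h := id_tensor_id_tensor a l (gen t .eps)
    exact h.symm ▸ Generated.death (t := t) (a + l)
  | strand _ hf =>
    rw [id_tensor_strand]
    exact hf.strand

theorem generated_ofWord (w : RookWord k l) : Generated t (ofWord t w) := by
  induction w with
  | gen g =>
    cases g with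
    -- `crossing 0` is `s` with the empty identity on its left, which the left unit law removes.
    | s => exact (congrArg (Generated t) (one_tensor (gen t .s))).mp (Generated.crossing 0)
    | eta => exact (congrArg (Generated t) (one_tensor (gen t .eta))).mp (Generated.birth 0)
    | eps => exact (congrArg (Generated t) (one_tensor (gen t .eps))).mp (Generated.death 0)
  | id k => exact .id k
  | comp v w hv hw =>
    rw [ofWord_comp]
    exact hv.comp hw
  | tensor v w hv hw =>
    rw [ofWord_tensor, tensor_eq]
    exact (hv.tensor_id _).comp (hw.id_tensor _)

/-- A word is its composite with the identity, and the identity is itself a normal form. -/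
theorem exists_isNormal (w : RookWord k l) :
    ∃ n f, IsNormal t k l f ∧ ofWord t w = addLoops n f := by
  have h := (isNormal_id (t := t) k).generated_comp (generated_ofWord (t := t) w)
  rwa [comp_id] at h

theorem Generated.exists_word {f : Tracked t k l} (hf : Generated t f) :
    ∃ w, ofWord t w = f := by
  induction hf with
  | id k => exact ⟨.id k, rfl⟩
  | comp _ _ hf hg =>
    obtain ⟨v, rfl⟩ := hf
    obtain ⟨w, rfl⟩ := hg
    exact ⟨v.comp w, ofWord_comp _ _⟩
  | crossing l => exact ⟨(RookWord.id l).tensor (.gen .s), rfl⟩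
  | birth l => exact ⟨(RookWord.id l).tensor (.gen .eta), rfl⟩
  | death l => exact ⟨(RookWord.id l).tensor (.gen .eps), rfl⟩
  | strand _ hf =>
    obtain ⟨v, rfl⟩ := hf
    exact ⟨v.tensor (.id 1), rfl⟩

theorem IsCycle.generated {c : Tracked t (l + 1) m} (hc : IsCycle t l m c) : Generated t c := by
  induction hc with
  | id l => exact .id _
  | step _ h => exact h.strand.comp (.crossing _)

theorem IsNormal.generated {f : Tracked t k m} (hf : IsNormal t k m f) : Generated t f := by
  induction hf with
  | nil => exact .id 0
  | birth _ h => exact (Generated.birth _).comp h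
  | death _ h => exact h.comp (.death _)
  | cycle hc _ h => exact hc.generated.comp h.strand

/-! ### Normal forms are determined by their rook diagrams -/

theorem rel_strand (f : Tracked t k l) (i : Fin k) (j : Fin l) :
    f.strand.diag.rel i.castSucc j.castSucc ↔ f.diag.rel i j :=
  RookDiagram.rel_tensor_left _ _ i j

theorem rel_strand_last (f : Tracked t k l) (j : Fin (l + 1)) :
    f.strand.diag.rel (Fin.last k) j ↔ j = Fin.last l := by
  refine Fin.lastCases ?_ (fun j => ?_) j
  · exact iff_of_true ((RookDiagram.rel_tensor_right f.diag (RookDiagram.one 1) 0 0).2 rfl) rfl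
  · exact iff_of_false (RookDiagram.not_rel_tensor_right_left f.diag (RookDiagram.one 1) 0 j)
      (Fin.castSucc_ne_last j)

theorem not_rel_strand (f : Tracked t k l) (i : Fin k) :
    ¬ f.strand.diag.rel i.castSucc (Fin.last l) :=
  RookDiagram.not_rel_tensor_left_right f.diag (RookDiagram.one 1) i 0

theorem rel_death (i : Fin (k + 1)) (j : Fin k) :
    (death t k).diag.rel i j ↔ i = j.castSucc := by
  refine (RookDiagram.rel_tensor (RookDiagram.one k) RookGen.eps.rook i j).trans ?_
  constructor
  · rintro (⟨a, b, rfl, h1, h2⟩ | ⟨a, b, -⟩)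
    · exact Fin.ext (h1.symm.trans h2)
    · exact b.elim0
  · rintro rfl
    exact Or.inl ⟨j, j, rfl, rfl, rfl⟩

theorem rel_birth (i : Fin k) : (birth t k).diag.rel i i.castSucc :=
  (RookDiagram.rel_tensor (RookDiagram.one k) RookGen.eta.rook i i.castSucc).2
    (Or.inl ⟨i, i, rfl, rfl, rfl⟩)

theorem rel_crossing_last (j : Fin (k + 2)) :
    (crossing t k).diag.rel (Fin.last (k + 1)) j ↔ j = (Fin.last k).castSucc := by
  have h : (crossing t k).diag.rel (Fin.last (k + 1)) (Fin.last k).castSucc :=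
    (RookDiagram.rel_tensor (RookDiagram.one k) RookGen.s.rook _ _).2
      (Or.inr ⟨1, 0, rfl, rfl, rfl⟩)
  constructor
  · exact fun h' => RookDiagram.rel_fun h' h
  · rintro rfl
    exact h

theorem rel_comp (f : Tracked t l m) (g : Tracked t k l) (i : Fin k) (j : Fin m) :
    (f.comp g).diag.rel i j ↔ ∃ b, g.diag.rel i b ∧ f.diag.rel b j :=
  RookDiagram.rel_star _ _ _ _

/-- A further step keeps the position where the carried strand ends and adds a top point on the
right. The end point therefore never is the last one after a step. -/
theorem rel_step (f : Tracked t (l + 1) m) (j : Fin (m + 1)) :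
    (f.strand.comp (crossing t l)).diag.rel (Fin.last (l + 1)) j ↔
      ∃ j', j = Fin.castSucc j' ∧ f.diag.rel (Fin.last l) j' := by
  rw [rel_comp]
  simp only [rel_crossing_last, exists_eq_left]
  refine Fin.lastCases ?_ (fun j => ?_) j
  · refine iff_of_false (not_rel_strand f _) ?_
    rintro ⟨j', h, -⟩
    exact Fin.castSucc_ne_last j' h.symm
  · rw [rel_strand]
    constructor
    · exact fun h => ⟨j, rfl, h⟩
    · rintro ⟨j', h, h'⟩
      rwa [Fin.castSucc_injective _ h]

/-- A cycle is a product of crossings, each its own inverse. Invertibility shows that cycles leave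
no vertex unmatched and contain no closed component, and it allows them to be cancelled or split
off. -/
theorem IsCycle.exists_inverse {c : Tracked t (l + 1) m} (hc : IsCycle t l m c) :
    ∃ d : Tracked t m (l + 1), d.comp c = Tracked.id t (l + 1) ∧ c.comp d = Tracked.id t m := by
  induction hc with
  | id l => exact ⟨Tracked.id t (l + 1), comp_id _, comp_id _⟩
  | @step l m f _ ih =>
    obtain ⟨d, h1, h2⟩ := ih
    refine ⟨(Tracked.crossing t l).comp d.strand, ?_, ?_⟩
    · calc _ = (Tracked.crossing t l).comp
            ((d.comp f).strand.comp (Tracked.crossing t l)) := by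
            rw [strand_comp, comp_assoc, comp_assoc]
        _ = _ := by
            rw [h1, strand_id]
            exact (congrArg _ (id_comp _)).trans (crossing_comp_crossing l)
    · calc _ = f.strand.comp (((Tracked.crossing t l).comp (Tracked.crossing t l)).comp
            d.strand) := by
            rw [comp_assoc, comp_assoc]
        _ = f.strand.comp d.strand := by
            rw [crossing_comp_crossing]
            exact congrArg _ (id_comp _)
        _ = _ := by rw [← strand_comp, h2, strand_id]

theorem IsCycle.exists_rel {c : Tracked t (l + 1) m} (hc : IsCycle t l m c) (i : Fin (l + 1)) :
    ∃ j, c.diag.rel i j := by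
  obtain ⟨d, h, -⟩ := hc.exists_inverse
  have h1 : (d.comp c).diag.rel i i := by
    rw [h]
    exact rfl
  obtain ⟨j, hj, -⟩ := (rel_comp _ _ _ _).1 h1
  exact ⟨j, hj⟩

theorem IsCycle.cnt_eq_zero {c : Tracked t (l + 1) m} (hc : IsCycle t l m c) : c.cnt = 0 := by
  obtain ⟨d, h, -⟩ := hc.exists_inverse
  have h1 : d.cnt + c.cnt + d.diag.loops c.diag = 0 := congrArg Tracked.cnt h
  omega

/-- At every composition in a normal form, each middle vertex is joined to an outer row: births and
cycles match all their bottom points, and deaths all their top points. -/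
theorem IsNormal.cnt_eq_zero {f : Tracked t k m} (hf : IsNormal t k m f) : f.cnt = 0 := by
  induction hf with
  | nil => rfl
  | @birth m f _ h =>
    have h1 : (Tracked.birth t m).diag.loops f.diag = 0 :=
      RookDiagram.loops_eq_zero fun j => Or.inr ⟨_, rel_birth j⟩
    change 0 + f.cnt + (Tracked.birth t m).diag.loops f.diag = 0
    omega
  | @death k m f _ h =>
    have h1 : f.diag.loops (Tracked.death t k).diag = 0 :=
      RookDiagram.loops_eq_zero fun j => Or.inl ⟨_, (rel_death _ _).2 rfl⟩
    change f.cnt + 0 + f.diag.loops (Tracked.death t k).diag = 0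
    omega
  | @cycle k l m c f hc _ h =>
    have h1 : c.diag.loops f.strand.diag = 0 :=
      RookDiagram.loops_eq_zero fun j => Or.inr (hc.exists_rel j)
    have h2 := hc.cnt_eq_zero
    change c.cnt + (f.cnt + 0) + c.diag.loops f.strand.diag = 0
    omega

theorem IsCycle.eq_add_one {c : Tracked t (l + 1) m} (hc : IsCycle t l m c) : m = l + 1 := by
  induction hc with
  | id l => rfl
  | step _ h => rw [h]

/-- The number of steps is visible in the end point of the carried strand: it is the last point
exactly for the identity, and each step puts one more point to its right. -/
theorem IsCycle.eq {c c' : Tracked t (l + 1) m} (hc : IsCycle t l m c)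
    (hc' : IsCycle t l m c') {j : Fin m} (h : c.diag.rel (Fin.last l) j)
    (h' : c'.diag.rel (Fin.last l) j) : c = c' := by
  induction hc with
  | id l =>
    cases hc' with
    | id => rfl
    | step hc' =>
      obtain rfl : Fin.last _ = j := h
      obtain ⟨j', hj, -⟩ := (rel_step _ _).1 h'
      exact (Fin.castSucc_ne_last j' hj.symm).elim
  | step hc ih =>
    obtain ⟨j', rfl, hj'⟩ := (rel_step _ _).1 h
    cases hc' with
    | id =>
      have h' : Fin.last _ = j'.castSucc := h'
      exact (Fin.castSucc_ne_last j' h'.symm).elim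
    | step hc' =>
      obtain ⟨j'', h1, hj''⟩ := (rel_step _ _).1 h'
      obtain rfl := Fin.castSucc_injective _ h1
      rw [ih hc' hj' hj'']

theorem IsNormal.eq_zero {f g : Tracked t 0 m} (hf : IsNormal t 0 m f)
    (hg : IsNormal t 0 m g) : f = g := by
  induction m with
  | zero => cases hf; cases hg; rfl
  | succ m ih =>
    cases hf with
    | birth hf =>
      cases hg with
      | birth hg => rw [ih hf hg]

theorem not_rel_comp_death_last (f : Tracked t k m) (j : Fin m) :
    ¬ (f.comp (death t k)).diag.rel (Fin.last k) j := by
  rw [rel_comp]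
  rintro ⟨b, h, -⟩
  rw [rel_death] at h
  exact Fin.castSucc_ne_last b h.symm

theorem rel_comp_death (f : Tracked t k m) (i : Fin k) (j : Fin m) :
    (f.comp (death t k)).diag.rel i.castSucc j ↔ f.diag.rel i j := by
  rw [rel_comp]
  simp only [rel_death]
  constructor
  · rintro ⟨b, h, h'⟩
    rwa [Fin.castSucc_injective _ h]
  · exact fun h => ⟨i, rfl, h⟩

theorem rel_cycle_last (c : Tracked t (l + 1) m) (f : Tracked t k l) (j : Fin m) :
    (c.comp f.strand).diag.rel (Fin.last k) j ↔ c.diag.rel (Fin.last l) j := by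
  rw [rel_comp]
  simp only [rel_strand_last, exists_eq_left]

/-- The last bottom vertex is isolated precisely for normal forms of death type. Otherwise its
partner determines the cycle, and the rest of the diagram is recovered after cancelling that cycle.
-/
theorem IsNormal.eq {f g : Tracked t k m} (hf : IsNormal t k m f) (hg : IsNormal t k m g)
    (h : f.diag = g.diag) : f = g := by
  induction hf with
  | nil => exact IsNormal.nil.eq_zero hg
  | birth hf => exact hf.birth.eq_zero hg
  | death hf ih =>
    cases hg with
    | death hg =>
      rw [ih hg]
      refine RookDiagram.rel_ext fun i j => ?_
      rw [← rel_comp_death, h, rel_comp_death]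
    | cycle hc hg =>
      obtain ⟨j, hj⟩ := hc.exists_rel (Fin.last _)
      rw [← rel_cycle_last, ← h] at hj
      exact (not_rel_comp_death_last _ _ hj).elim
  | cycle hc hf ih =>
    cases hg with
    | death hg =>
      obtain ⟨j, hj⟩ := hc.exists_rel (Fin.last _)
      rw [← rel_cycle_last, h] at hj
      exact (not_rel_comp_death_last _ _ hj).elim
    | cycle hc' hg =>
      -- The intermediate sizes of the two normal forms are independent a priori; both are one less
      -- than the size of the top row.
      have h1 := hc.eq_add_one.symm.trans hc'.eq_add_one
      obtain rfl := Nat.succ_injective h1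
      obtain ⟨j, hj⟩ := hc.exists_rel (Fin.last _)
      have hj' := hj
      rw [← rel_cycle_last, h, rel_cycle_last] at hj'
      obtain rfl := hc.eq hc' hj hj'
      obtain ⟨d, hd, -⟩ := hc.exists_inverse
      rw [ih hg]
      -- Composing with the inverse of the common cycle leaves an equality of diagrams with an added
      -- strand, to be restricted to the other vertices.
      have key := congrArg d.diag.star h
      change (d.comp (Tracked.comp _ _)).diag = (d.comp (Tracked.comp _ _)).diag at key
      rw [← comp_assoc, ← comp_assoc, hd, id_comp, id_comp] at key
      refine RookDiagram.rel_ext fun i j => ?_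
      rw [← rel_strand, key, rel_strand]

/-! ### Existence of normal forms -/

theorem exists_isCycle (t : 𝕜) : ∀ (l : ℕ) (j : Fin (l + 1)),
    ∃ c, IsCycle t l (l + 1) c ∧ c.diag.rel (Fin.last l) j
  | 0, j => ⟨_, .id 0, Subsingleton.elim (α := Fin 1) _ _⟩
  | l + 1, j => by
    refine Fin.lastCases ?_ (fun j => ?_) j
    · exact ⟨_, .id (l + 1), rfl⟩
    · obtain ⟨c, hc, h⟩ := exists_isCycle t l j
      exact ⟨_, hc.step, (rel_step _ _).2 ⟨j, rfl, h⟩⟩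

theorem exists_isNormal_zero (t : 𝕜) : ∀ m : ℕ, ∃ f, IsNormal t 0 m f
  | 0 => ⟨_, .nil⟩
  | m + 1 => by
    obtain ⟨f, hf⟩ := exists_isNormal_zero t m
    exact ⟨_, hf.birth⟩

/-- Induction on the bottom row. An isolated last vertex is split off as a death. A matched one is
first brought to the last top position by the inverse of a cycle, and is then a free strand on the
right. -/
theorem exists_isNormal_diag (t : 𝕜) : ∀ (k : ℕ) {m : ℕ} (D : RookDiagram k m),
    ∃ f, IsNormal t k m f ∧ f.diag = D
  | 0, m, D => by
    obtain ⟨f, hf⟩ := exists_isNormal_zero t m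
    exact ⟨f, hf, RookDiagram.rel_ext fun i => i.elim0⟩
  | k + 1, m, D => by
    by_cases h : ∃ j, D.rel (Fin.last k) j
    · obtain ⟨j, hj⟩ := h
      cases m with
      | zero => exact j.elim0
      | succ l =>
        obtain ⟨c, hc, hcj⟩ := exists_isCycle t l j
        obtain ⟨d, hd, hd'⟩ := hc.exists_inverse
        have hdj : d.diag.rel j (Fin.last l) := by
          have h1 : (d.comp c).diag.rel (Fin.last l) (Fin.last l) := by
            rw [hd]
            exact rfl
          obtain ⟨b, h2, h3⟩ := (rel_comp _ _ _ _).1 h1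
          rwa [RookDiagram.rel_fun hcj h2]
        have hlast : (d.diag.star D).rel (Fin.last k) (Fin.last l) :=
          (RookDiagram.rel_star _ _ _ _).2 ⟨j, hj, hdj⟩
        -- Since `d ⋆ D` joins the two last vertices to each other, it is its restriction to the
        -- remaining vertices with a strand added.
        obtain ⟨f, hf, hfD⟩ := exists_isNormal_diag t k
          ((d.diag.star D).restrict (Fin.castSucc_injective k) (Fin.castSucc_injective l))
        refine ⟨_, .cycle hc hf, ?_⟩
        have hs : f.strand.diag = d.diag.star D := by
          refine RookDiagram.rel_ext fun i x => ?_
          refine Fin.lastCases ?_ (fun i => ?_) i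
          · rw [rel_strand_last]
            constructor
            · rintro rfl
              exact hlast
            · exact fun h => RookDiagram.rel_fun h hlast
          · refine Fin.lastCases ?_ (fun x => ?_) x
            · refine iff_of_false (not_rel_strand f i) fun h => ?_
              exact Fin.castSucc_ne_last i (RookDiagram.rel_inj h hlast)
            · rw [rel_strand, hfD]
              exact Iff.rfl
        change c.diag.star f.strand.diag = D
        rw [hs, ← RookDiagram.star_assoc]
        have h1 : c.diag.star d.diag = RookDiagram.one (l + 1) := congrArg Tracked.diag hd'
        rw [h1, RookDiagram.one_star]
    · obtain ⟨f, hf, hfD⟩ := exists_isNormal_diag t k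
        (D.restrict (Fin.castSucc_injective k) Function.injective_id)
      refine ⟨_, hf.death, RookDiagram.rel_ext fun i x => ?_⟩
      refine Fin.lastCases ?_ (fun i => ?_) i
      · exact iff_of_false (not_rel_comp_death_last f x) fun h' => h ⟨x, h'⟩
      · rw [rel_comp_death, hfD]
        exact Iff.rfl

end Tracked


/-! ## The basis of rook diagrams -/

section Basis

variable {𝕜 : Type u} [CommRing 𝕜] (t : 𝕜)

/-- The morphism of the rook category given by a rook diagram. -/
def RookDiagram.toHom {k l : ℕ} (D : RookDiagram k l) : PHom (RookRel t) k l :=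
  (Tracked.exists_isNormal_diag t k D).choose.hom

/-- Normal forms are built from generators, hence represented by words, and have no closed
components. -/
theorem RookDiagram.exists_word {k l : ℕ} (D : RookDiagram k l) :
    ∃ w : RookWord k l, w.rook = D ∧ w.loops = 0 ∧
      (PHom.mk (w.toTerm 𝕜) : PHom (RookRel t) k l) = D.toHom t := by
  obtain ⟨hf, hD⟩ := (Tracked.exists_isNormal_diag t k D).choose_spec
  obtain ⟨w, hw⟩ := hf.generated.exists_word
  refine ⟨w, ?_, ?_, congrArg Tracked.hom hw⟩
  · rw [← hD, ← hw]
    rfl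
  · rw [← hf.cnt_eq_zero, ← hw]
    rfl

/-- The tracked equality with a normal form compares all three components: the count gives the
exponent, and the diagram identifies the normal form with the one chosen in `toHom`, by uniqueness.
-/
theorem RookWord.mk_toTerm {k l : ℕ} (w : RookWord k l) :
    (PHom.mk (w.toTerm 𝕜) : PHom (RookRel t) k l) = t ^ w.loops • w.rook.toHom t := by
  obtain ⟨n, f, hf, h⟩ := Tracked.exists_isNormal (t := t) w
  obtain ⟨hg, hD⟩ := (Tracked.exists_isNormal_diag t k w.rook).choose_spec
  have h1 : w.loops = n := by
    have := congrArg Tracked.cnt h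
    change w.loops = n + f.cnt at this
    rw [this, hf.cnt_eq_zero, Nat.add_zero]
  have h2 : w.rook = f.diag := congrArg Tracked.diag h
  rw [RookDiagram.toHom, hg.eq hf (hD.trans h2), h1]
  exact congrArg Tracked.hom h

theorem PHom.eval_toHom {k l : ℕ} (D : RookDiagram k l) :
    PHom.eval t k l (D.toHom t) = Finsupp.single D 1 := by
  obtain ⟨w, rfl, hw, h⟩ := D.exists_word t
  rw [← h, PHom.eval_word, hw, pow_zero]

/-- Composition in the rook category, as a bilinear map. -/
def PHom.compₗ (k l m : ℕ) :
    PHom (RookRel t) l m →ₗ[𝕜] PHom (RookRel t) k l →ₗ[𝕜] PHom (RookRel t) k m :=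
  LinearMap.mk₂ 𝕜 PHom.comp
    (fun f g h => by
      obtain ⟨f, rfl⟩ := exists_rep f
      obtain ⟨g, rfl⟩ := exists_rep g
      obtain ⟨h, rfl⟩ := exists_rep h
      exact sound (.add_comp f g h))
    (fun a f g => by
      obtain ⟨f, rfl⟩ := exists_rep f
      obtain ⟨g, rfl⟩ := exists_rep g
      exact sound (.smul_comp a f g))
    (fun f g h => by
      obtain ⟨f, rfl⟩ := exists_rep f
      obtain ⟨g, rfl⟩ := exists_rep g
      obtain ⟨h, rfl⟩ := exists_rep h
      exact sound (.comp_add f g h))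
    (fun a f g => by
      obtain ⟨f, rfl⟩ := exists_rep f
      obtain ⟨g, rfl⟩ := exists_rep g
      exact sound (.comp_smul a f g))

/-- The tensor product in the rook category, as a bilinear map. -/
def PHom.tensorₗ (k l k' l' : ℕ) :
    PHom (RookRel t) k l →ₗ[𝕜] PHom (RookRel t) k' l' →ₗ[𝕜]
      PHom (RookRel t) (k + k') (l + l') :=
  LinearMap.mk₂ 𝕜 PHom.tensor
    (fun f g h => by
      obtain ⟨f, rfl⟩ := exists_rep f
      obtain ⟨g, rfl⟩ := exists_rep g
      obtain ⟨h, rfl⟩ := exists_rep h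
      exact sound (.add_tensor f g h))
    (fun a f g => by
      obtain ⟨f, rfl⟩ := exists_rep f
      obtain ⟨g, rfl⟩ := exists_rep g
      exact sound (.smul_tensor a f g))
    (fun f g h => by
      obtain ⟨f, rfl⟩ := exists_rep f
      obtain ⟨g, rfl⟩ := exists_rep g
      obtain ⟨h, rfl⟩ := exists_rep h
      exact sound (.tensor_add f g h))
    (fun a f g => by
      obtain ⟨f, rfl⟩ := exists_rep f
      obtain ⟨g, rfl⟩ := exists_rep g
      exact sound (.tensor_smul a f g))

/-- Sums and scalars can be moved outside, because composition and tensor product are bilinear. -/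
theorem PHom.mk_mem_span_words {k l : ℕ} (f : RookTerm 𝕜 k l) :
    (PHom.mk f : PHom (RookRel t) k l) ∈ Submodule.span 𝕜
      (Set.range fun w : RookWord k l => (PHom.mk (w.toTerm 𝕜) : PHom (RookRel t) k l)) := by
  induction f with
  | gen g => exact Submodule.subset_span ⟨.gen g, rfl⟩
  | id k => exact Submodule.subset_span ⟨.id k, rfl⟩
  | comp f g hf hg =>
    have h := Submodule.apply_mem_map₂ (PHom.compₗ t _ _ _) hf hg
    rw [Submodule.map₂_span_span] at h
    refine Submodule.span_mono ?_ h
    rintro _ ⟨_, ⟨v, rfl⟩, _, ⟨w, rfl⟩, rfl⟩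
    exact ⟨v.comp w, rfl⟩
  | tensor f g hf hg =>
    have h := Submodule.apply_mem_map₂ (PHom.tensorₗ t _ _ _ _) hf hg
    rw [Submodule.map₂_span_span] at h
    refine Submodule.span_mono ?_ h
    rintro _ ⟨_, ⟨v, rfl⟩, _, ⟨w, rfl⟩, rfl⟩
    exact ⟨v.tensor w, rfl⟩
  | zero k l => exact Submodule.zero_mem _
  | add f g hf hg => exact Submodule.add_mem _ hf hg
  | smul a f hf => exact Submodule.smul_mem _ a hf

theorem PHom.span_toHom (k l : ℕ) :
    Submodule.span 𝕜 (Set.range fun D : RookDiagram k l => D.toHom t) = ⊤ := by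
  refine eq_top_iff.2 fun f _ => ?_
  obtain ⟨f, rfl⟩ := exists_rep f
  refine (Submodule.span_le.2 ?_) (PHom.mk_mem_span_words t f)
  rintro _ ⟨w, rfl⟩
  change PHom.mk (w.toTerm 𝕜) ∈ _
  rw [RookWord.mk_toTerm]
  exact Submodule.smul_mem _ _ (Submodule.subset_span ⟨_, rfl⟩)

/-- Evaluation maps this family to the standard basis of the free module on rook diagrams. -/
theorem PHom.linearIndependent_toHom (k l : ℕ) :
    LinearIndependent 𝕜 fun D : RookDiagram k l => D.toHom t := by
  refine LinearIndependent.of_comp (PHom.eval t k l) ?_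
  have h : (PHom.eval t k l ∘ fun D : RookDiagram k l => D.toHom t) =
      fun D => Finsupp.single D 1 := funext fun D => PHom.eval_toHom t D
  rw [h]
  exact Finsupp.linearIndependent_single_one 𝕜 _

/-- The basis of a morphism space of the rook category given by the rook diagrams. -/
def rookBasis (k l : ℕ) : Module.Basis (RookDiagram k l) 𝕜 (PHom (RookRel t) k l) :=
  Module.Basis.mk (PHom.linearIndependent_toHom t k l) (PHom.span_toHom t k l).ge

theorem rookBasis_apply {k l : ℕ} (D : RookDiagram k l) : rookBasis t k l D = D.toHom t :=
  Module.Basis.mk_apply _ _ D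

/-! ## The endomorphism algebras -/

/-- For words without closed components, those of the composite word are exactly the ones created by
the stacking. -/
theorem RookDiagram.toHom_comp_toHom {k l m : ℕ} (D : RookDiagram l m) (D' : RookDiagram k l) :
    (D.toHom t).comp (D'.toHom t) = t ^ D.loops D' • (D.star D').toHom t := by
  obtain ⟨v, rfl, hv, h⟩ := D.exists_word t
  obtain ⟨w, rfl, hw, h'⟩ := D'.exists_word t
  rw [← h, ← h']
  have h := RookWord.mk_toTerm t (v.comp w)
  rw [RookWord.loops_comp, hv, hw, Nat.zero_add] at h
  exact h

/-- The linear map from an endomorphism space of the rook category to the partition algebra. -/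
def endToPartition (k : ℕ) : PHom (RookRel t) k k →ₗ[𝕜] PartitionAlgebra t k :=
  (rookBasis t k k).constr 𝕜 fun D => PartitionAlgebra.diagram t D.1

theorem endToPartition_toHom {k : ℕ} (D : RookDiagram k k) :
    endToPartition t k (D.toHom t) = PartitionAlgebra.diagram t D.1 := by
  rw [← rookBasis_apply, endToPartition, Module.Basis.constr_basis]

theorem endToPartition_comp {k : ℕ} (f g : PHom (RookRel t) k k) :
    endToPartition t k (f.comp g) = endToPartition t k f * endToPartition t k g := by
  have h : (PHom.compₗ t k k k).compr₂ (endToPartition t k) =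
      ((LinearMap.mul 𝕜 (PartitionAlgebra t k)).compl₁₂ (endToPartition t k)
        (endToPartition t k)) := by
    refine (rookBasis t k k).ext fun D => (rookBasis t k k).ext fun D' => ?_
    rw [rookBasis_apply, rookBasis_apply]
    change endToPartition t k ((D.toHom t).comp (D'.toHom t)) =
      endToPartition t k (D.toHom t) * endToPartition t k (D'.toHom t)
    rw [RookDiagram.toHom_comp_toHom, map_smul]
    simp only [endToPartition_toHom, PartitionAlgebra.diagram_mul_diagram]
    rfl
  exact congrArg (fun φ : PHom (RookRel t) k k →ₗ[𝕜] PHom (RookRel t) k k →ₗ[𝕜]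
    PartitionAlgebra t k => φ f g) h

theorem endToPartition_id (k : ℕ) : endToPartition t k (PHom.mk (Term.id k)) = 1 := by
  have h := RookWord.mk_toTerm t (RookWord.id k)
  rw [RookWord.loops, pow_zero, one_smul] at h
  exact (congrArg _ h).trans (endToPartition_toHom t _)

theorem endToPartition_injective (k : ℕ) : Function.Injective (endToPartition t k) := by
  -- The basis is mapped to distinct standard basis vectors of the partition algebra.
  have h : LinearIndependent 𝕜 (fun D : RookDiagram k k => PartitionAlgebra.diagram t D.1) :=
    (Finsupp.linearIndependent_single_one 𝕜 (PartitionDiagram k k)).comp _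
      Subtype.val_injective
  rw [injective_iff_map_eq_zero]
  intro x hx
  rw [endToPartition, Module.Basis.constr_apply] at hx
  have h1 := linearIndependent_iff.1 h _ hx
  exact (rookBasis t k k).repr.map_eq_zero_iff.1 h1

theorem range_endToPartition (k : ℕ) :
    LinearMap.range (endToPartition t k) = Subalgebra.toSubmodule (rookAlgebra t k) :=
  Module.Basis.constr_range _ _

/-- The endomorphism algebra of an object of the rook category is the rook algebra. -/
def endEquivRookAlgebra (k : ℕ) : End (RookCategory.obj t k) ≃ₐ[𝕜] rookAlgebra t k :=
  AlgEquiv.ofLinearEquiv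
    ((LinearEquiv.ofInjective (endToPartition t k) (endToPartition_injective t k)).trans
      (LinearEquiv.ofEq _ _ (range_endToPartition t k)))
    (Subtype.ext (endToPartition_id t k))
    -- The product in `End` is composition in functional order, which agrees with `PHom.comp` and
    -- with stacking the first factor on top.
    (fun f g => Subtype.ext (endToPartition_comp t f g))

end Basis

end RookTheory

/-- For every `t` in a commutative ring `𝕜`, the morphism spaces `Hom(k, l)` of the rook category
`R(t)` have bases `b k l` given by the rook diagrams `k → l`: a rook diagram `D` is the basis
vector `b k l D`, every diagram built from the generators `s`, `η`, `ε` represents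
`t ^ (number of closed components)` times the rook diagram that it draws, and every rook diagram
is drawn in this way without closed components. The resulting map from the endomorphism algebra
`End(k)` to the rook algebra `R_k(t)` is an isomorphism of algebras. -/
theorem mainTheorem2 {𝕜 : Type*} [CommRing 𝕜] (t : 𝕜) :
    ∃ b : ∀ k l : ℕ, Module.Basis (RookTheory.RookDiagram k l) 𝕜
        (RookTheory.RookCategory.obj t k ⟶ RookTheory.RookCategory.obj t l),
      (∀ (k l : ℕ) (w : RookTheory.RookWord k l), ∃ D : RookTheory.RookDiagram k l,
        D.1 = w.diagram ∧ w.toHom t = t ^ w.loops • b k l D) ∧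
      (∀ (k l : ℕ) (D : RookTheory.RookDiagram k l), ∃ w : RookTheory.RookWord k l,
        w.diagram = D.1 ∧ w.loops = 0) ∧
      (∀ k : ℕ, ∃ Φ : End (RookTheory.RookCategory.obj t k) ≃ₐ[𝕜] RookTheory.rookAlgebra t k,
        ∀ D : RookTheory.RookDiagram k k,
          (Φ (b k k D) : RookTheory.PartitionAlgebra t k) =
            RookTheory.PartitionAlgebra.diagram t D.1) := by
  refine ⟨RookTheory.rookBasis t, fun k l w => ⟨w.rook, w.rook_val, ?_⟩, fun k l D => ?_,
    fun k => ⟨RookTheory.endEquivRookAlgebra t k, fun D => ?_⟩⟩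
  · have h := w.mk_toTerm t
    rw [← RookTheory.rookBasis_apply] at h
    exact h
  · obtain ⟨w, rfl, hw, -⟩ := D.exists_word t
    exact ⟨w, w.rook_val.symm, hw⟩
  · exact Module.Basis.constr_basis (RookTheory.rookBasis t k k) 𝕜 _ D
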